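/- A state in $M_m(\mathbb C)\otimes M_n(\mathbb C)$ is a positive semidefinite matrix of trace one. It is absolutely PPT if, for every unitary $U$ of order $mn$, the partial transpose $(\mathrm{id}_m\otimes T)(U\rho U^\dagger)$ is positive semidefinite; $\mathcal{AP}_{m,n}$ denotes the (convex) set of absolutely PPT states, and an extreme state is an extreme point of this set. A state $\rho\in\mathcal{AP}_{m,n}$ is an interior point if $\frac{1}{1-\epsilon}\left(\rho-\epsilon\frac{1}{mn}I_{mn}\right)\in\mathcal{AP}_{m,n}$ for some $0<\epsilon<1$, and a boundary point otherwise. Let $x\approx 2.70928$ be the largest root of $x^3-x^2-5x+1=0$, and let \begin{align*} \zeta_1&=\tfrac{1}{11}\,\mathrm{diag}(3,1,1,1,1,1,1,1,1),\\ \zeta_2&=\tfrac{1}{9+2\sqrt2}\,\mathrm{diag}(\sqrt2+1,\sqrt2+1,1,1,1,1,1,1,1),\\ \zeta_3&=\tfrac1{12}\,\mathrm{diag}(2,2,2,1,1,1,1,1,1),\\ \zeta_4&=\tfrac1{10+\sqrt{17}}\,\mathrm{diag}\left(\tfrac{5+\sqrt{17}}4,\tfrac{5+\sqrt{17}}4,\tfrac{5+\sqrt{17}}4,\tfrac{5+\sqrt{17}}4,1,1,1,1,1\right),\\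 \zeta_5&=\tfrac1{5x+4}\,\mathrm{diag}(x,x,x,x,x,1,1,1,1),\\ \zeta_6&=\tfrac1{21}\,\mathrm{diag}(3,3,3,3,3,3,1,1,1),\\ \zeta_7&=\tfrac1{23+14\sqrt2}\,\mathrm{diag}(3+2\sqrt2,\ldots,3+2\sqrt2,1,1)\quad(\text{seven entries } 3+2\sqrt2),\\ \zeta_8&=\tfrac18\,\mathrm{diag}(1,1,1,1,1,1,1,1,0). \end{align*} (i) Each of $\zeta_1,\ldots,\zeta_8$ belongs to $\mathcal{AP}_{3,3}$ and has exactly two distinct eigenvalues. If $\rho\in\mathcal{AP}_{3,3}$ has exactly two distinct eigenvalues, then $\rho$ is an extreme point of $\mathcal{AP}_{3,3}$ if and only if $\rho=U\zeta_kU^\dagger$ for some unitary $U$ and some $k\in\{1,\ldots,8\}$. (ii) Every boundary point $\rho$ of $\mathcal{AP}_{3,3}$ whose eigenvalues, in non-increasing order and with multiplicity, are $(a,b,c,c,c,c,c,c,c)$ with $a>b>c$ is an extreme point of $\mathcal{AP}_{3,3}$. (iii) For every $n\ge 1$ (in particular for $n=3$), every extreme point of $\mathcal{AP}_{3,n}$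 has at most seven distinct eigenvalues. -/

import Mathlib

open scoped ComplexOrder

/-- An `m × n` quantum state: a positive semidefinite matrix of trace one on `ℂᵐ ⊗ ℂⁿ`, whose
standard product basis is indexed by `Fin m × Fin n`. -/
def IsQuantumState {m n : ℕ} (ρ : Matrix (Fin m × Fin n) (Fin m × Fin n) ℂ) : Prop :=
  ρ.PosSemidef ∧ ρ.trace = 1

/-- The partial transpose `(id ⊗ T) ρ` with respect to the second factor. -/
def partialTranspose {m n : ℕ} (ρ : Matrix (Fin m × Fin n) (Fin m × Fin n) ℂ) :
    Matrix (Fin m × Fin n) (Fin m × Fin n) ℂ :=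
  Matrix.of fun p q => ρ (p.1, q.2) (q.1, p.2)

/-- Unitary equivalence `ρ = U σ U†`. -/
def UnitarilyEquivalent {m n : ℕ} (ρ σ : Matrix (Fin m × Fin n) (Fin m × Fin n) ℂ) : Prop :=
  ∃ U ∈ Matrix.unitaryGroup (Fin m × Fin n) ℂ, ρ = U * σ * U.conjTranspose

/-- The set of absolutely PPT `m × n` states: states whose partial transpose stays positive
semidefinite after every global unitary conjugation. -/
def AP (m n : ℕ) : Set (Matrix (Fin m × Fin n) (Fin m × Fin n) ℂ) :=
  {ρ | IsQuantumState ρ ∧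
    ∀ U ∈ Matrix.unitaryGroup (Fin m × Fin n) ℂ,
      (partialTranspose (U * ρ * U.conjTranspose)).PosSemidef}

/-- Interior points of the set of absolutely PPT states: one can move a little away from the
maximally mixed state `I / (mn)` and remain in the set. -/
def IsInteriorPointAP {m n : ℕ} (ρ : Matrix (Fin m × Fin n) (Fin m × Fin n) ℂ) : Prop :=
  ρ ∈ AP m n ∧ ∃ ε : ℝ, 0 < ε ∧ ε < 1 ∧
    (1 / (1 - ε)) • (ρ - (ε / ((m : ℝ) * (n : ℝ))) •
      (1 : Matrix (Fin m × Fin n) (Fin m × Fin n) ℂ)) ∈ AP m n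

/-- Boundary points: the points of the set that are not interior points. -/
def IsBoundaryPointAP {m n : ℕ} (ρ : Matrix (Fin m × Fin n) (Fin m × Fin n) ℂ) : Prop :=
  ρ ∈ AP m n ∧ ¬ IsInteriorPointAP ρ

/-- `x` is the eigenvalue vector of `M`: its entries are in non-increasing order and list the
eigenvalues of `M` with multiplicity (in particular `N` is the order of `M`). -/
def HasEigenvalueVector {d : Type*} [Fintype d] [DecidableEq d] {N : ℕ}
    (M : Matrix d d ℂ) (x : Fin N → ℝ) : Prop :=
  Antitone x ∧ M.charpoly.roots = Finset.univ.val.map (fun i => (x i : ℂ))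

/-- The diagonal matrix `diag(v₁, …, v₉)` on `ℂ³ ⊗ ℂ³`, the product basis being ordered
lexicographically. -/
noncomputable def diag33 (v : Fin 9 → ℝ) : Matrix (Fin 3 × Fin 3) (Fin 3 × Fin 3) ℂ :=
  Matrix.diagonal fun p => ((v (finProdFinEquiv p) : ℝ) : ℂ)

/-- The eight states `ζ₁, …, ζ₈` (indexed from `0`); `x` is the parameter of `ζ₅`. -/
noncomputable def zeta (x : ℝ) : Fin 8 → Matrix (Fin 3 × Fin 3) (Fin 3 × Fin 3) ℂ :=
  ![(1 / 11 : ℝ) • diag33 ![3, 1, 1, 1, 1, 1, 1, 1, 1],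
    (1 / (9 + 2 * √2) : ℝ) • diag33 ![√2 + 1, √2 + 1, 1, 1, 1, 1, 1, 1, 1],
    (1 / 12 : ℝ) • diag33 ![2, 2, 2, 1, 1, 1, 1, 1, 1],
    (1 / (10 + √17) : ℝ) • diag33 ![(5 + √17) / 4, (5 + √17) / 4, (5 + √17) / 4,
      (5 + √17) / 4, 1, 1, 1, 1, 1],
    (1 / (5 * x + 4) : ℝ) • diag33 ![x, x, x, x, x, 1, 1, 1, 1],
    (1 / 21 : ℝ) • diag33 ![3, 3, 3, 3, 3, 3, 1, 1, 1],
    (1 / (23 + 14 * √2) : ℝ) • diag33 ![3 + 2 * √2, 3 + 2 * √2, 3 + 2 * √2, 3 + 2 * √2,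
      3 + 2 * √2, 3 + 2 * √2, 3 + 2 * √2, 1, 1],
    (1 / 8 : ℝ) • diag33 ![1, 1, 1, 1, 1, 1, 1, 1, 0]]

/-! Evaluating a partial transpose at a vector with Schmidt coefficients x₀ ≥ x₁ ≥ x₂ ≥ 0 pairs the
conjugated state with an operator whose eigenvalues are the xᵢ², the ±xᵢxⱼ and zeros. The local
unitaries of the Schmidt decomposition are absorbed into the global one, Birkhoff's theorem reduces
global unitaries to permutations of the spectrum, and the rearrangement inequality selects the
permutation that pairs large eigenvalues with small products. The order of the products is forced
except between x₀x₂ and x₁². Hence, for n ≥ 3, absolute PPT means that two ternary quadratic forms,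
linear in the spectrum, are nonnegative (Hildebrand's criterion: `conj_mem_AP` and
`formsNonneg_of_mem_AP`).

The bound seven is a dimension count (`extreme_card_le_seven`). With more than seven eigenvalues,
the mixed coefficients of both forms are strictly negative, so each form has a nondegenerate block
and a critical vector. A small perturbation of the spectrum keeps a form nonnegative if its gradient
at that vector vanishes. This gives three conditions per form and one for the trace, so a nonzero
direction constant on the level sets survives and the state is a midpoint.

Extremality rests on `face_rigidity`. Let a diagonal state have a form with a zero x, and let it lie
inside a segment of the convex set. Every unitary commuting with the state preserves this zero, so
each endpoint has value zero at x after each such conjugation. Small rotations between different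
eigenvalues, together with permutations and rotations inside the eigenspaces, then force the
endpoint to be diagonal and constant on the level sets. The remaining linear equations (value or
gradient at x, and trace) have a single solution.

For two levels there is one ratio of eigenvalues per multiplicity at which a form acquires a zero.
Any other two-level state with that multiplicity is a mixture of this one with the maximally mixed
state, so it is not extreme. -/

open Matrix

/-! ### Diagonalization and singular values -/

section Spectral

variable {ι : Type*} [Fintype ι] [DecidableEq ι]

/-- The complex diagonal matrix with the given real entries. -/
noncomputable def realDiagonal (f : ι → ℝ) : Matrix ι ι ℂ := diagonal fun i => (f i : ℂ)

lemma permMatrix_mem_unitaryGroup (π : Equiv.Perm ι) : π.permMatrix ℂ ∈ unitaryGroup ι ℂ := by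
  rw [mem_unitaryGroup_iff, star_eq_conjTranspose, conjTranspose_permMatrix, ← permMatrix_mul]
  simp

lemma permMatrix_conj (π : Equiv.Perm ι) (M : Matrix ι ι ℂ) :
    π.permMatrix ℂ * M * (π.permMatrix ℂ)ᴴ = M.submatrix π π := by
  ext i j
  simp [Matrix.mul_apply, PEquiv.toMatrix_apply, Equiv.symm_apply_eq]

lemma conj_realDiagonal_comp_perm (π : Equiv.Perm ι) (f : ι → ℝ) :
    ∃ P ∈ unitaryGroup ι ℂ, realDiagonal (f ∘ π) = P * realDiagonal f * Pᴴ := by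
  refine ⟨π.permMatrix ℂ, permMatrix_mem_unitaryGroup π, ?_⟩
  rw [permMatrix_conj, realDiagonal, realDiagonal, submatrix_diagonal _ _ π.injective]
  rfl

lemma exists_perm_antivary {ι : Type*} [Fintype ι] (f : ι → ℝ) (r : ι → ℕ) : ∃ π : Equiv.Perm ι, Antivary (f ∘ π) r := by
  let e := Fintype.equivFin ι
  -- Positions are sorted by increasing rank and by decreasing value; matching the two orders gives
  -- the permutation.
  let a := Tuple.sort (r ∘ e.symm)
  let b := Tuple.sort (fun i => - (f ∘ e.symm) i)
  refine ⟨((e.trans a.symm).trans b).trans e.symm, fun i j hij => ?_⟩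
  have ha : Monotone ((r ∘ e.symm) ∘ a) := Tuple.monotone_sort _
  have hb : Monotone ((fun i => - (f ∘ e.symm) i) ∘ b) := Tuple.monotone_sort _
  have h1 : a.symm (e i) ≤ a.symm (e j) := by
    by_contra! h
    have := ha h.le
    simp at this
    omega
  have := hb h1
  simpa using this

lemma exists_unitary_diagonalization {ρ : Matrix ι ι ℂ} (h : ρ.IsHermitian) :
    ∃ U ∈ unitaryGroup ι ℂ, ρ = U * realDiagonal h.eigenvalues * Uᴴ := by
  refine ⟨h.eigenvectorUnitary, h.eigenvectorUnitary.2, ?_⟩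
  conv_lhs => rw [h.spectral_theorem]
  rfl

lemma exists_sorted_diagonalization {ρ : Matrix ι ι ℂ} (h : ρ.IsHermitian) (r : ι → ℕ) :
    ∃ U ∈ unitaryGroup ι ℂ, ∃ f : ι → ℝ, ρ = U * realDiagonal f * Uᴴ ∧ Antivary f r := by
  obtain ⟨U, hU, hρ⟩ := exists_unitary_diagonalization h
  obtain ⟨π, hπ⟩ := exists_perm_antivary h.eigenvalues r
  obtain ⟨P, hP, hd⟩ := conj_realDiagonal_comp_perm π.symm (h.eigenvalues ∘ π)
  refine ⟨U * P, mul_mem hU hP, _, ?_, hπ⟩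
  have e : (h.eigenvalues ∘ π) ∘ π.symm = h.eigenvalues := by ext; simp
  rw [e] at hd
  calc ρ = U * realDiagonal h.eigenvalues * Uᴴ := hρ
    _ = _ := by rw [hd, conjTranspose_mul]; simp only [Matrix.mul_assoc]

lemma spectrum_unitary_conj {U : Matrix ι ι ℂ} (hU : U ∈ unitaryGroup ι ℂ) (f : ι → ℝ) :
    spectrum ℂ (U * realDiagonal f * Uᴴ) = Complex.ofReal '' Set.range f := by
  have := Unitary.spectrum_star_right_conjugate (R := ℂ) (a := realDiagonal f) (U := ⟨U, hU⟩)
  simp only [star_eq_conjTranspose] at this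
  rw [this, realDiagonal, spectrum_diagonal]
  ext; simp

/-- Singular value decomposition with sorted singular values. -/
lemma exists_svd {n : ℕ} (hn : 3 ≤ n) (Ψ : Matrix (Fin 3) (Fin n) ℂ) :
    ∃ A ∈ unitaryGroup (Fin 3) ℂ, ∃ B ∈ unitaryGroup (Fin n) ℂ, ∃ x : Fin 3 → ℝ,
      x 1 ≤ x 0 ∧ x 2 ≤ x 1 ∧ 0 ≤ x 2 ∧
      ∀ i j, Ψ i j = ∑ k, A i k * x k * B (Fin.castLE hn k) j := by
  have hS : (Ψ * Ψᴴ).IsHermitian := isHermitian_mul_conjTranspose_self Ψ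
  obtain ⟨A, hA, f, hf, hr⟩ := exists_sorted_diagonalization hS (fun i => (i : ℕ))
  have hAA : Aᴴ * A = 1 := mem_unitaryGroup_iff'.1 hA
  have hAA' : A * Aᴴ = 1 := mem_unitaryGroup_iff.1 hA
  set R := Aᴴ * Ψ with hR
  have hRR : R * Rᴴ = realDiagonal f := by
    rw [hR, conjTranspose_mul, conjTranspose_conjTranspose]
    calc Aᴴ * Ψ * (Ψᴴ * A) = Aᴴ * (Ψ * Ψᴴ) * A := by simp only [Matrix.mul_assoc]
      _ = (Aᴴ * A) * realDiagonal f * (Aᴴ * A) := by rw [hf]; simp only [Matrix.mul_assoc]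
      _ = _ := by rw [hAA]; simp
  have hent : ∀ i j, ∑ l, R i l * star (R j l) = if i = j then (f i : ℂ) else 0 := by
    intro i j
    have := congrFun (congrFun hRR i) j
    simpa [Matrix.mul_apply, realDiagonal, diagonal_apply] using this
  have hnn : ∀ i, ∑ l, ‖R i l‖ ^ 2 = f i := by
    intro i
    have := hent i i
    simp only [Complex.star_def, Complex.mul_conj, if_true] at this
    simp only [← Complex.normSq_eq_norm_sq]
    exact_mod_cast this
  have hf0 : ∀ i, 0 ≤ f i := fun i => by rw [← hnn]; positivity
  have hmono : ∀ i j : Fin 3, i < j → √(f j) ≤ √(f i) := fun i j hij => Real.sqrt_le_sqrt (hr hij)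
  -- The rows of `R` are orthogonal with squared norms `f`. The nonzero ones, normalized, extend to
  -- an orthonormal basis, which supplies the rows of `B`.
  let v : Fin n → EuclideanSpace ℂ (Fin n) := fun j =>
    if h : (j : ℕ) < 3 then ((1 / √(f ⟨j, h⟩) : ℝ) : ℂ) • WithLp.toLp 2 (R.row ⟨j, h⟩) else 0
  let s : Set (Fin n) := {j | ∃ h : (j : ℕ) < 3, f ⟨j, h⟩ ≠ 0}
  have hv : Orthonormal ℂ (s.domRestrict v) := by
    rw [orthonormal_iff_ite]
    rintro ⟨i, hi, hi'⟩ ⟨j, hj, hj'⟩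
    simp only [Set.domRestrict_apply, v, hi, hj, dif_pos, inner_smul_left, inner_smul_right,
      Subtype.mk.injEq]
    have h1 : inner ℂ (WithLp.toLp 2 (R.row ⟨i, hi⟩)) (WithLp.toLp 2 (R.row ⟨j, hj⟩)) =
        if (⟨j, hj⟩ : Fin 3) = ⟨i, hi⟩ then (f ⟨j, hj⟩ : ℂ) else 0 := by
      rw [← hent]
      simp [PiLp.inner_apply]
    rw [h1]
    by_cases hij : i = j
    · subst hij
      have : (√(f ⟨i, hi⟩) : ℂ) ≠ 0 := by
        exact_mod_cast (Real.sqrt_pos.2 (lt_of_le_of_ne (hf0 _) (Ne.symm hi'))).ne'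
      have h2 : (f ⟨i, hi⟩ : ℂ) = √(f ⟨i, hi⟩) * √(f ⟨i, hi⟩) := by
        exact_mod_cast (Real.mul_self_sqrt (hf0 _)).symm
      simp only [if_true, Complex.conj_ofReal]
      rw [h2]
      push_cast
      field_simp
    · have : ¬ (⟨j, hj⟩ : Fin 3) = ⟨i, hi⟩ := fun h => hij (Fin.ext (Fin.mk.inj_iff.1 h).symm)
      simp [this, hij]
  obtain ⟨b, hb⟩ := hv.exists_orthonormalBasis_extension_of_card_eq (by simp)
  refine ⟨A, hA, Matrix.of fun j l => b j l, ?_, fun k => √(f k), hmono _ _ (by decide),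
    hmono _ _ (by decide), Real.sqrt_nonneg _, ?_⟩
  · rw [mem_unitaryGroup_iff]
    ext i j
    have := orthonormal_iff_ite.1 b.orthonormal j i
    simp only [PiLp.inner_apply, RCLike.inner_apply] at this
    simp only [Matrix.mul_apply, star_apply, one_apply]
    simpa [eq_comm] using this
  · intro i j
    have hΨ : Ψ = A * R := by rw [hR, ← Matrix.mul_assoc, hAA', Matrix.one_mul]
    conv_lhs => rw [hΨ]
    rw [Matrix.mul_apply]
    refine Finset.sum_congr rfl fun k _ => ?_
    rw [mul_assoc]
    congr 1
    -- A zero singular value means a zero row of `R`, so the arbitrary completing vector has no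
    -- effect.
    by_cases hk : f k = 0
    · have h0 := hnn k
      rw [hk, Finset.sum_eq_zero_iff_of_nonneg (fun _ _ => by positivity)] at h0
      have := h0 j (Finset.mem_univ _)
      simp at this
      simp [this, hk]
    · have hbk := hb (Fin.castLE hn k) ⟨k.2, hk⟩
      change R k j = _ * b (Fin.castLE hn k) j
      rw [hbk]
      have : (√(f k) : ℂ) ≠ 0 := by
        exact_mod_cast (Real.sqrt_pos.2 (lt_of_le_of_ne (hf0 _) (Ne.symm hk))).ne'
      simp [v, k.2, this]

end Spectral

/-! ### From partial transposes to quadratic forms in the Schmidt coefficients -/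

section Criterion

variable {n : ℕ}

/-- Extension by zero of a vector of Schmidt coefficients. -/
def extendZero (x : Fin 3 → ℝ) (j : ℕ) : ℝ := if h : j < 3 then x ⟨j, h⟩ else 0

/-- The eigenvalues of the partial transpose of the projection onto `∑ xᵢ eᵢ ⊗ eᵢ`: the value at
`(i, j)` is `xᵢ xⱼ` for `i ≤ j` and `- xᵢ xⱼ` for `j < i`. -/
def ptEigenvalue (x : Fin 3 → ℝ) (p : Fin 3 × Fin n) : ℝ :=
  (if (p.2 : ℕ) < p.1 then -1 else 1) * (x p.1 * extendZero x p.2)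

lemma sum_extendZero (hn : 3 ≤ n) {R : Type*} [AddCommMonoid R] (g : Fin n → R)
    (hg : ∀ j : Fin n, 3 ≤ (j : ℕ) → g j = 0) :
    ∑ j, g j = ∑ j : Fin 3, g (Fin.castLE hn j) := by
  obtain ⟨m, rfl⟩ := Nat.exists_eq_add_of_le' hn
  rw [Fin.sum_univ_succ, Fin.sum_univ_succ, Fin.sum_univ_succ, Finset.sum_eq_zero, add_zero,
    Fin.sum_univ_three]
  · exact (add_assoc _ _ _).symm
  · intro i _
    exact hg _ (by simp)

/-- The diagonal values paired with `ptEigenvalue`. -/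
noncomputable def diagForm (d : Fin 3 × Fin n → ℝ) (x : Fin 3 → ℝ) : ℝ :=
  ∑ p, d p * ptEigenvalue x p

/-- The vector of real parts of the diagonal. -/
def diagRe {ι : Type*} (M : Matrix ι ι ℂ) (p : ι) : ℝ := (M p p).re

/-- Only the 3 × 3 corner contributes, and the indices (i, j) and (j, i) carry opposite signs,
whence the differences in the mixed coefficients. -/
lemma diagForm_eq (hn : 3 ≤ n) (d : Fin 3 × Fin n → ℝ) (x : Fin 3 → ℝ) :
    diagForm d x =
      d (0, Fin.castLE hn 0) * x 0 ^ 2 + d (1, Fin.castLE hn 1) * x 1 ^ 2 +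
      d (2, Fin.castLE hn 2) * x 2 ^ 2 +
      (d (0, Fin.castLE hn 1) - d (1, Fin.castLE hn 0)) * (x 0 * x 1) +
      (d (0, Fin.castLE hn 2) - d (2, Fin.castLE hn 0)) * (x 0 * x 2) +
      (d (1, Fin.castLE hn 2) - d (2, Fin.castLE hn 1)) * (x 1 * x 2) := by
  unfold diagForm
  rw [Fintype.sum_prod_type]
  have : ∀ i : Fin 3, ∑ j : Fin n, d (i, j) * ptEigenvalue x (i, j) =
      ∑ j : Fin 3, d (i, Fin.castLE hn j) * ptEigenvalue x (i, Fin.castLE hn j) := by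
    intro i
    refine sum_extendZero hn _ fun j hj => ?_
    simp [ptEigenvalue, extendZero, hj]
  simp only [this, Fin.sum_univ_three]
  simp [ptEigenvalue, extendZero]
  ring

/-- Exchange of the two tensor indices inside the `3 × 3` corner. -/
def swapIndex (hn : 3 ≤ n) (p : Fin 3 × Fin n) : Fin 3 × Fin n :=
  if h : (p.2 : ℕ) < 3 then (⟨p.2, h⟩, Fin.castLE hn p.1) else p

lemma swapIndex_swapIndex (hn : 3 ≤ n) (p : Fin 3 × Fin n) :
    swapIndex hn (swapIndex hn p) = p := by
  unfold swapIndex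
  split_ifs with h <;> simp_all

@[simp] lemma swapIndex_castLE (hn : 3 ≤ n) (i j : Fin 3) :
    swapIndex hn (i, Fin.castLE hn j) = (j, Fin.castLE hn i) := by
  simp [swapIndex]

/-- The sign `±1` of `ptEigenvalue`. -/
def indexSign (p : Fin 3 × Fin n) : ℝ := if (p.2 : ℕ) < p.1 then -1 else 1

lemma indexSign_sq (p : Fin 3 × Fin n) : indexSign p * indexSign p = 1 := by
  unfold indexSign; split_ifs <;> norm_num

lemma indexSign_swapIndex (hn : 3 ≤ n) (p : Fin 3 × Fin n) (h : swapIndex hn p ≠ p) :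
    indexSign (swapIndex hn p) = - indexSign p := by
  unfold swapIndex at h ⊢
  split_ifs at h ⊢ with h1
  · have : (p.2 : ℕ) ≠ p.1 := by
      intro e
      apply h
      ext <;> simp [e]
    unfold indexSign
    simp only [Fin.val_castLE]
    split_ifs <;> first | omega | norm_num
  · exact absurd rfl h

/-- The unitary whose rows are `eᵢ ⊗ eᵢ` and `(eᵢ ⊗ eⱼ ± eⱼ ⊗ eᵢ) / √2`. -/
noncomputable def symmetrizer (hn : 3 ≤ n) : Matrix (Fin 3 × Fin n) (Fin 3 × Fin n) ℂ :=
  Matrix.of fun p q => if swapIndex hn p = p then (if q = p then 1 else 0) else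
    (if q = p then ((indexSign p / √2 : ℝ) : ℂ) else 0) +
      (if q = swapIndex hn p then ((1 / √2 : ℝ) : ℂ) else 0)

lemma symmetrizer_conjTranspose (hn : 3 ≤ n) : (symmetrizer hn)ᴴ = symmetrizer hn := by
  ext p q
  by_cases hpq : p = q
  · subst hpq
    by_cases h : swapIndex hn p = p
    · simp [symmetrizer, conjTranspose_apply, h]
    · simp [symmetrizer, conjTranspose_apply, h, Ne.symm h]
  by_cases hs : q = swapIndex hn p
  · have hp : p = swapIndex hn q := by rw [hs, swapIndex_swapIndex]
    have h1 : ¬ swapIndex hn p = p := fun h => hpq (by rw [hs, h])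
    have h2 : ¬ swapIndex hn q = q := fun h => hpq (by rw [hp, h])
    simp only [symmetrizer, conjTranspose_apply, of_apply, if_neg h1, if_neg h2, if_neg hpq,
      if_neg (Ne.symm hpq), if_pos hs, if_pos hp]
    simp
  · have hp : ¬ p = swapIndex hn q := fun h => hs (by rw [h, swapIndex_swapIndex])
    simp [symmetrizer, conjTranspose_apply, hp, hs, hpq, Ne.symm hpq]

lemma symmetrizer_mul_apply (hn : 3 ≤ n) (M : Matrix (Fin 3 × Fin n) (Fin 3 × Fin n) ℂ)
    (p q : Fin 3 × Fin n) :
    (symmetrizer hn * M) p q = if swapIndex hn p = p then M p q else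
      (indexSign p / √2 : ℝ) * M p q + (1 / √2 : ℝ) * M (swapIndex hn p) q := by
  rw [Matrix.mul_apply]
  split_ifs with h
  · simp [symmetrizer, h]
  · simp [symmetrizer, h, add_mul, Finset.sum_add_distrib]

lemma mul_symmetrizer_apply (hn : 3 ≤ n) (M : Matrix (Fin 3 × Fin n) (Fin 3 × Fin n) ℂ)
    (p q : Fin 3 × Fin n) :
    (M * symmetrizer hn) p q = if swapIndex hn q = q then M p q else
      (indexSign q / √2 : ℝ) * M p q + (1 / √2 : ℝ) * M p (swapIndex hn q) := by
  have : M * symmetrizer hn = (symmetrizer hn * Mᴴ)ᴴ := by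
    rw [conjTranspose_mul, symmetrizer_conjTranspose, conjTranspose_conjTranspose]
  rw [this, conjTranspose_apply, symmetrizer_mul_apply]
  split_ifs <;> simp

lemma inv_sqrt_two_mul_self : ((1 / √2 : ℝ) : ℂ) * ((1 / √2 : ℝ) : ℂ) = 1 / 2 := by
  rw [← Complex.ofReal_mul, div_mul_div_comm, Real.mul_self_sqrt (by norm_num)]
  norm_num

lemma symmetrizer_mem_unitaryGroup (hn : 3 ≤ n) :
    symmetrizer hn ∈ unitaryGroup (Fin 3 × Fin n) ℂ := by
  rw [mem_unitaryGroup_iff, star_eq_conjTranspose, symmetrizer_conjTranspose]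
  ext p q
  rw [symmetrizer_mul_apply]
  split_ifs with h
  · simp [symmetrizer, h, one_apply, eq_comm]
  · have hs := indexSign_swapIndex hn p h
    simp only [symmetrizer, of_apply, if_neg h, swapIndex_swapIndex, hs]
    have e1 := inv_sqrt_two_mul_self
    have e2 : (indexSign p : ℂ) * indexSign p = 1 := by exact_mod_cast indexSign_sq p
    push_cast at e1 ⊢
    by_cases hqp : q = p
    · subst hqp
      simp only [one_apply_eq, if_true, if_neg (Ne.symm h)]
      linear_combination (indexSign q * indexSign q + 1) * e1 + 1 / 2 * e2
    · by_cases hqs : q = swapIndex hn p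
      · subst hqs
        simp only [if_neg h, if_neg (Ne.symm h), if_true, one_apply_ne (Ne.symm h)]
        ring
      · simp [hqp, hqs, one_apply_ne (Ne.symm hqp)]

/-- In the basis given by the symmetrizer, the partial transpose of a Schmidt vector projection is
diagonal. -/
lemma diagForm_symmetrizer (hn : 3 ≤ n) (M : Matrix (Fin 3 × Fin n) (Fin 3 × Fin n) ℂ)
    (x : Fin 3 → ℝ) :
    diagForm (diagRe (symmetrizer hn * M * (symmetrizer hn)ᴴ)) x =
      ∑ i, ∑ j, x i * x j * (M (i, Fin.castLE hn j) (j, Fin.castLE hn i)).re := by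
  have e1 := inv_sqrt_two_mul_self
  rw [symmetrizer_conjTranspose, diagForm_eq hn]
  have hd : ∀ i : Fin 3, diagRe (symmetrizer hn * M * symmetrizer hn) (i, Fin.castLE hn i) =
      (M (i, Fin.castLE hn i) (i, Fin.castLE hn i)).re := by
    intro i
    simp [diagRe, mul_symmetrizer_apply, symmetrizer_mul_apply]
  -- Between the symmetric and the antisymmetric vector the diagonal entries differ exactly by the
  -- cross terms, which are the entries moved by the partial transpose.
  have ho : ∀ i j : Fin 3, i < j → diagRe (symmetrizer hn * M * symmetrizer hn) (i, Fin.castLE hn j)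
      - diagRe (symmetrizer hn * M * symmetrizer hn) (j, Fin.castLE hn i) =
      (M (i, Fin.castLE hn j) (j, Fin.castLE hn i)).re
      + (M (j, Fin.castLE hn i) (i, Fin.castLE hn j)).re := by
    intro i j hij
    have h1 : ¬ (j = i) := hij.ne'
    have h2 : ¬ (i = j) := hij.ne
    have h3 : ¬ ((j : ℕ) < i) := by have := Fin.lt_def.1 hij; omega
    have h4 : ((i : ℕ) < j) := hij
    rw [← Complex.add_re, diagRe, diagRe, ← Complex.sub_re]
    congr 1
    simp only [mul_symmetrizer_apply, symmetrizer_mul_apply, swapIndex_castLE, Prod.mk.injEq, h1,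
      h2, false_and, if_false, indexSign, Fin.val_castLE, h3, h4, if_true]
    push_cast at e1 ⊢
    linear_combination (2 * M (i, Fin.castLE hn j) (j, Fin.castLE hn i)
      + 2 * M (j, Fin.castLE hn i) (i, Fin.castLE hn j)) * e1
  simp only [hd, ho 0 1 (by decide), ho 0 2 (by decide), ho 1 2 (by decide), Fin.sum_univ_three]
  ring

lemma partialTranspose_isHermitian {M : Matrix (Fin 3 × Fin n) (Fin 3 × Fin n) ℂ}
    (hM : M.IsHermitian) : (partialTranspose M).IsHermitian := by
  ext p q
  simpa [partialTranspose] using congrFun (congrFun hM (p.1, q.2)) (q.1, p.2)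

lemma sum_comm_four {α β γ δ : Type*} [Fintype α] [Fintype β] [Fintype γ] [Fintype δ]
    (F : α → β → γ → δ → ℂ) :
    ∑ p, ∑ q, ∑ a, ∑ b, F p q a b = ∑ a, ∑ b, ∑ p, ∑ q, F p q a b := by
  calc ∑ p, ∑ q, ∑ a, ∑ b, F p q a b = ∑ p, ∑ a, ∑ q, ∑ b, F p q a b :=
        Finset.sum_congr rfl fun _ _ => Finset.sum_comm
    _ = ∑ a, ∑ p, ∑ q, ∑ b, F p q a b := Finset.sum_comm
    _ = ∑ a, ∑ p, ∑ b, ∑ q, F p q a b :=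
        Finset.sum_congr rfl fun _ _ => Finset.sum_congr rfl fun _ _ => Finset.sum_comm
    _ = ∑ a, ∑ b, ∑ p, ∑ q, F p q a b := Finset.sum_congr rfl fun _ _ => Finset.sum_comm

/-- The vector is (A ⊗ Bᵀ) ∑ xₖ eₖ ⊗ eₖ, and partial transposition moves the factors on the second
tensor leg to the other side of `M`. The result is conjugation of `M` by Aᴴ ⊗ B. -/
lemma schmidt_quadraticForm (hn : 3 ≤ n) (M : Matrix (Fin 3 × Fin n) (Fin 3 × Fin n) ℂ)
    {A : Matrix (Fin 3) (Fin 3) ℂ} {B : Matrix (Fin n) (Fin n) ℂ} (x : Fin 3 → ℝ)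
    (ψ : Fin 3 × Fin n → ℂ)
    (hψ : ∀ i j, ψ (i, j) = ∑ k, A i k * x k * B (Fin.castLE hn k) j) :
    star ψ ⬝ᵥ (partialTranspose M *ᵥ ψ) =
      ∑ a, ∑ b, (x a * x b : ℂ) * ((Matrix.kronecker Aᴴ B) * M * (Matrix.kronecker Aᴴ B)ᴴ)
        (a, Fin.castLE hn b) (b, Fin.castLE hn a) := by
  have hL : star ψ ⬝ᵥ (partialTranspose M *ᵥ ψ) = ∑ p : Fin 3 × Fin n, ∑ q : Fin 3 × Fin n,
      ∑ a, ∑ b, (x a * x b : ℂ) * (star (A p.1 a) * B (Fin.castLE hn b) q.2 *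
        M (p.1, q.2) (q.1, p.2) * (A q.1 b * star (B (Fin.castLE hn a) p.2))) := by
    simp only [dotProduct, mulVec, Pi.star_apply, Finset.mul_sum]
    refine Finset.sum_congr rfl fun p _ => Finset.sum_congr rfl fun q _ => ?_
    rw [hψ p.1 p.2, hψ q.1 q.2, star_sum, Finset.sum_mul]
    refine Finset.sum_congr rfl fun a _ => ?_
    rw [Finset.mul_sum, Finset.mul_sum]
    refine Finset.sum_congr rfl fun b _ => ?_
    simp only [partialTranspose, of_apply, star_mul', Complex.star_def, Complex.conj_ofReal]
    ring
  rw [hL, sum_comm_four]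
  refine Finset.sum_congr rfl fun a _ => Finset.sum_congr rfl fun b _ => ?_
  have hK : ∀ p q, Matrix.kronecker Aᴴ B p q = star (A q.1 p.1) * B p.2 q.2 := fun _ _ => rfl
  simp only [Matrix.mul_apply, Finset.mul_sum, Finset.sum_mul, Fintype.sum_prod_type,
    hK, conjTranspose_apply, star_mul', star_star]
  calc _ = ∑ i, ∑ k, ∑ l, ∑ j, _ := Finset.sum_congr rfl fun _ _ => Finset.sum_comm
    _ = ∑ k, ∑ i, ∑ l, ∑ j, _ := Finset.sum_comm
    _ = ∑ k, ∑ l, ∑ i, ∑ j, _ := Finset.sum_congr rfl fun _ _ => Finset.sum_comm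
    _ = _ := rfl

/-- Each test vector has a Schmidt decomposition with sorted coefficients; its local unitaries and
the symmetrizer merge with `U` into a single `W`. -/
lemma mem_AP_of_diagForm_nonneg (hn : 3 ≤ n) {σ : Matrix (Fin 3 × Fin n) (Fin 3 × Fin n) ℂ}
    (hσ : IsQuantumState σ)
    (h : ∀ W ∈ unitaryGroup (Fin 3 × Fin n) ℂ, ∀ x : Fin 3 → ℝ, x 1 ≤ x 0 → x 2 ≤ x 1 → 0 ≤ x 2 →
      0 ≤ diagForm (diagRe (W * σ * Wᴴ)) x) : σ ∈ AP 3 n := by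
  refine ⟨hσ, fun U hU => ?_⟩
  have hM : (U * σ * Uᴴ).IsHermitian := isHermitian_mul_mul_conjTranspose U hσ.1.1
  have hMT := partialTranspose_isHermitian hM
  refine PosSemidef.of_dotProduct_mulVec_nonneg hMT fun ψ => ?_
  obtain ⟨A, hA, B, hB, x, h01, h12, h2, hΨ⟩ := exists_svd hn (Matrix.of fun i j => ψ (i, j))
  have hA' : Aᴴ ∈ unitaryGroup (Fin 3) ℂ := Unitary.star_mem hA
  set K := Matrix.kronecker Aᴴ B with hK
  have hKu : K ∈ unitaryGroup (Fin 3 × Fin n) ℂ := kronecker_mem_unitary hA' hB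
  have := h (symmetrizer hn * (K * U))
    (mul_mem (symmetrizer_mem_unitaryGroup hn) (mul_mem hKu hU)) x h01 h12 h2
  have e : symmetrizer hn * (K * U) * σ * (symmetrizer hn * (K * U))ᴴ =
      symmetrizer hn * (K * (U * σ * Uᴴ) * Kᴴ) * (symmetrizer hn)ᴴ := by
    simp only [conjTranspose_mul, Matrix.mul_assoc]
  rw [e, diagForm_symmetrizer] at this
  have e2 := schmidt_quadraticForm hn (U * σ * Uᴴ) x ψ hΨ
  have hre : (star ψ ⬝ᵥ (partialTranspose (U * σ * Uᴴ) *ᵥ ψ)).re = ∑ i, ∑ j, x i * x j *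
      ((K * (U * σ * Uᴴ) * Kᴴ) (i, Fin.castLE hn j) (j, Fin.castLE hn i)).re := by
    rw [e2, Complex.re_sum]
    refine Finset.sum_congr rfl fun i _ => ?_
    rw [Complex.re_sum]
    refine Finset.sum_congr rfl fun j _ => ?_
    rw [← Complex.ofReal_mul, Complex.re_ofReal_mul]
  rw [Complex.nonneg_iff]
  exact ⟨hre ▸ this, (hMT.im_star_dotProduct_mulVec_self ψ).symm⟩

/-- Undoing the symmetrizer turns the form into the expectation at ∑ xₖ eₖ ⊗ eₖ. No ordering or sign
of `x` is needed in this direction. -/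
lemma diagForm_nonneg_of_mem_AP (hn : 3 ≤ n) {σ : Matrix (Fin 3 × Fin n) (Fin 3 × Fin n) ℂ}
    (hσ : σ ∈ AP 3 n) {W : Matrix (Fin 3 × Fin n) (Fin 3 × Fin n) ℂ}
    (hW : W ∈ unitaryGroup (Fin 3 × Fin n) ℂ) (x : Fin 3 → ℝ) :
    0 ≤ diagForm (diagRe (W * σ * Wᴴ)) x := by
  have hG := symmetrizer_mem_unitaryGroup hn
  set G := symmetrizer hn
  have hGG : G * Gᴴ = 1 := mem_unitaryGroup_iff.1 hG
  set U := Gᴴ * W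
  have hU : U ∈ unitaryGroup (Fin 3 × Fin n) ℂ := mul_mem (Unitary.star_mem hG) hW
  have e : W * σ * Wᴴ = G * (U * σ * Uᴴ) * Gᴴ := by
    calc W * σ * Wᴴ = (G * Gᴴ) * W * σ * (Wᴴ * (G * Gᴴ)) := by rw [hGG]; simp
      _ = _ := by
        simp only [U, conjTranspose_mul, conjTranspose_conjTranspose, Matrix.mul_assoc]
  rw [e, diagForm_symmetrizer]
  let ψ : Fin 3 × Fin n → ℂ := fun p =>
    ∑ k, (1 : Matrix (Fin 3) (Fin 3) ℂ) p.1 k * x k *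
      (1 : Matrix (Fin n) (Fin n) ℂ) (Fin.castLE hn k) p.2
  have h1 := (hσ.2 U hU).dotProduct_mulVec_nonneg ψ
  rw [schmidt_quadraticForm hn (U * σ * Uᴴ) x ψ fun _ _ => rfl] at h1
  have h2 := (Complex.nonneg_iff.1 h1).1
  have hk : Matrix.kronecker (1 : Matrix (Fin 3) (Fin 3) ℂ)ᴴ (1 : Matrix (Fin n) (Fin n) ℂ) = 1 := by
    rw [conjTranspose_one]; exact one_kronecker_one
  rw [hk] at h2
  simp only [conjTranspose_one, Matrix.one_mul, Matrix.mul_one, Complex.re_sum,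
    ← Complex.ofReal_mul, Complex.re_ofReal_mul] at h2
  exact h2

end Criterion

/-! ### Diagonals of unitary conjugates and Birkhoff's theorem -/

section Unitary

variable {ι : Type*} [Fintype ι] [DecidableEq ι]

lemma unitary_normSq_mem_doublyStochastic {W : Matrix ι ι ℂ} (hW : W ∈ unitaryGroup ι ℂ) :
    (Matrix.of fun i j => Complex.normSq (W i j)) ∈ doublyStochastic ℝ ι := by
  rw [mem_doublyStochastic_iff_sum]
  refine ⟨fun i j => Complex.normSq_nonneg _, fun i => ?_, fun j => ?_⟩
  · have := congrFun (congrFun (mem_unitaryGroup_iff.1 hW) i) i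
    simp only [Matrix.mul_apply, star_apply, Complex.star_def, Complex.mul_conj, one_apply_eq]
      at this
    exact_mod_cast this
  · have := congrFun (congrFun (mem_unitaryGroup_iff'.1 hW) j) j
    simp only [Matrix.mul_apply, star_apply, Complex.star_def, mul_comm (starRingEnd ℂ _),
      Complex.mul_conj, one_apply_eq] at this
    exact_mod_cast this

lemma diagRe_conj_realDiagonal (W : Matrix ι ι ℂ) (f : ι → ℝ) (p : ι) :
    diagRe (W * realDiagonal f * Wᴴ) p = ∑ q, Complex.normSq (W p q) * f q := by
  rw [diagRe, Matrix.mul_apply, Complex.re_sum]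
  refine Finset.sum_congr rfl fun q _ => ?_
  rw [realDiagonal, mul_diagonal, conjTranspose_apply, Complex.star_def, mul_right_comm,
    Complex.mul_conj, ← Complex.ofReal_mul, Complex.ofReal_re]

/-- A bilinear pairing of the diagonal of a unitary conjugate of a diagonal matrix is nonnegative if
it is for all rearrangements. -/
lemma sum_diagRe_mul_nonneg_of_perm {f h : ι → ℝ}
    (hf : ∀ π : Equiv.Perm ι, 0 ≤ ∑ p, f (π p) * h p) {W : Matrix ι ι ℂ}
    (hW : W ∈ unitaryGroup ι ℂ) :
    0 ≤ ∑ p, diagRe (W * realDiagonal f * Wᴴ) p * h p := by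
  -- The diagonal is the average of `f` by the doubly stochastic matrix |W p q|², which is a convex
  -- combination of permutation matrices.
  obtain ⟨w, hw0, -, hw⟩ :=
    exists_eq_sum_perm_of_mem_doublyStochastic (unitary_normSq_mem_doublyStochastic hW)
  have key : ∀ p, diagRe (W * realDiagonal f * Wᴴ) p = ∑ π : Equiv.Perm ι, w π * f (π p) := by
    intro p
    have hent : ∀ q, Complex.normSq (W p q) = ∑ π : Equiv.Perm ι, w π * (if q = π p then 1 else 0) := by
      intro q
      have := congrFun (congrFun hw p) q
      rw [of_apply] at this
      rw [← this, Matrix.sum_apply]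
      simp [PEquiv.toMatrix_apply, eq_comm]
    rw [diagRe_conj_realDiagonal]
    simp only [hent, Finset.sum_mul]
    rw [Finset.sum_comm]
    refine Finset.sum_congr rfl fun π _ => ?_
    simp
  simp only [key, Finset.sum_mul]
  rw [Finset.sum_comm]
  refine Finset.sum_nonneg fun π _ => ?_
  simp only [mul_assoc]
  rw [← Finset.mul_sum]
  exact mul_nonneg (hw0 π) (hf π)

end Unitary

/-! ### Hildebrand's criterion via rearrangement -/

section Rearrangement

variable {n : ℕ}

/-- Position of an index in the increasing order of `ptEigenvalue`; the zero eigenvalues share the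
rank `3`. -/
def indexRank (p : Fin 3 × Fin n) : ℕ :=
  match (p.1 : ℕ), (p.2 : ℕ) with
  | 1, 0 => 0
  | 2, 0 => 1
  | 2, 1 => 2
  | 2, 2 => 4
  | 1, 2 => 5
  | 0, 2 => 6
  | 1, 1 => 7
  | 0, 1 => 8
  | 0, 0 => 9
  | _, _ => 3

/-- Value of `ptEigenvalue` in terms of the rank. -/
def rankEigenvalue (x : Fin 3 → ℝ) : ℕ → ℝ
  | 0 => -(x 0 * x 1)
  | 1 => -(x 0 * x 2)
  | 2 => -(x 1 * x 2)
  | 3 => 0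
  | 4 => x 2 ^ 2
  | 5 => x 1 * x 2
  | 6 => x 0 * x 2
  | 7 => x 1 ^ 2
  | 8 => x 0 * x 1
  | _ => x 0 ^ 2

lemma index_cases {n : ℕ} (hn : 3 ≤ n) (p : Fin 3 × Fin n) :
    3 ≤ (p.2 : ℕ) ∨ ∃ i j : Fin 3, p = (i, Fin.castLE hn j) := by
  by_cases h : (p.2 : ℕ) < 3
  · exact .inr ⟨p.1, ⟨p.2, h⟩, by ext <;> simp⟩
  · exact .inl (by omega)

lemma indexRank_of_le {p : Fin 3 × Fin n} (h : 3 ≤ (p.2 : ℕ)) : indexRank p = 3 := by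
  obtain ⟨i, ⟨j, hj⟩⟩ := p
  obtain ⟨k, rfl⟩ := Nat.exists_eq_add_of_le' h
  fin_cases i <;> rfl

lemma indexRank_castLE (hn : 3 ≤ n) (i j : Fin 3) :
    indexRank (i, Fin.castLE hn j) = ![![9, 8, 6], ![0, 7, 5], ![1, 2, 4]] i j := by
  fin_cases i <;> fin_cases j <;> rfl

lemma ptEigenvalue_eq_rankEigenvalue (x : Fin 3 → ℝ) (p : Fin 3 × Fin n) (hn : 3 ≤ n) :
    ptEigenvalue x p = rankEigenvalue x (indexRank p) := by
  rcases index_cases hn p with h | ⟨i, j, rfl⟩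
  · rw [indexRank_of_le h]
    simp [ptEigenvalue, extendZero, h, rankEigenvalue]
  · rw [indexRank_castLE]
    fin_cases i <;> fin_cases j <;> simp [ptEigenvalue, extendZero, rankEigenvalue] <;> ring

/-- The exchange of the indices of `x₀ x₂` and `x₁²`. -/
def midSwap (hn : 3 ≤ n) : Equiv.Perm (Fin 3 × Fin n) :=
  Equiv.swap (0, Fin.castLE hn 2) (1, Fin.castLE hn 1)

lemma indexRank_midSwap (hn : 3 ≤ n) (p : Fin 3 × Fin n) :
    indexRank (midSwap hn p) = Equiv.swap 6 7 (indexRank p) := by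
  rcases index_cases hn p with h | ⟨i, j, rfl⟩
  · have : midSwap hn p = p := by
      apply Equiv.swap_apply_of_ne_of_ne <;> rintro rfl <;> simp at h
    rw [this, indexRank_of_le h]
    rfl
  · have : midSwap hn (i, Fin.castLE hn j) =
        ((Equiv.swap (0, 2) (1, 1) (i, j)).1, Fin.castLE hn (Equiv.swap (0, 2) (1, 1) (i, j)).2) := by
      simp only [midSwap, Equiv.swap_apply_def, Prod.mk.injEq, (Fin.castLE_injective hn).eq_iff]
      split_ifs <;> simp
    rw [this, indexRank_castLE, indexRank_castLE]
    clear this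
    revert i j
    decide

/-- The last hypothesis settles the only comparison that sortedness of `x` leaves open, between
ranks 6 and 7. -/
lemma rankEigenvalue_monotone {x : Fin 3 → ℝ} (h01 : x 1 ≤ x 0) (h12 : x 2 ≤ x 1) (h2 : 0 ≤ x 2)
    (h : x 0 * x 2 ≤ x 1 ^ 2) : Monotone (rankEigenvalue x) := by
  have h1 := h2.trans h12
  have h0 := h1.trans h01
  refine monotone_nat_of_le_succ fun k => ?_
  match k with
  | 0 | 1 | 2 | 3 | 4 | 5 | 6 | 7 | 8 => simp only [rankEigenvalue]; nlinarith
  | k + 9 => exact le_of_eq rfl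

lemma rankEigenvalue_swap_monotone {x : Fin 3 → ℝ} (h01 : x 1 ≤ x 0) (h12 : x 2 ≤ x 1)
    (h2 : 0 ≤ x 2) (h : x 1 ^ 2 ≤ x 0 * x 2) : Monotone (rankEigenvalue x ∘ Equiv.swap 6 7) := by
  have h1 := h2.trans h12
  have h0 := h1.trans h01
  refine monotone_nat_of_le_succ fun k => ?_
  have hs : ∀ k, k ≠ 6 → k ≠ 7 → Equiv.swap 6 7 k = k := fun k => Equiv.swap_apply_of_ne_of_ne
  match k with
  | 0 | 1 | 2 | 3 | 4 | 8 => simp [hs, rankEigenvalue]; try nlinarith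
  | 5 => simp [hs, rankEigenvalue]; nlinarith
  | 6 => simpa [rankEigenvalue] using h
  | 7 => simp [hs, rankEigenvalue]; nlinarith
  | k + 9 => simp [hs, rankEigenvalue]

/-- The two quadratic forms of Hildebrand's criterion are nonnegative. -/
def FormsNonneg (hn : 3 ≤ n) (f : Fin 3 × Fin n → ℝ) : Prop :=
  ∀ x : Fin 3 → ℝ, 0 ≤ diagForm f x ∧ 0 ≤ diagForm (f ∘ midSwap hn) x

/-- By the rearrangement inequality the opposite ordering minimizes the pairing. Which of the two
forms is this minimum depends on the sign of x₁² − x₀x₂. -/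
lemma diagForm_perm_nonneg (hn : 3 ≤ n) {f : Fin 3 × Fin n → ℝ} (hf : Antivary f indexRank)
    (hC : FormsNonneg hn f) {x : Fin 3 → ℝ} (h01 : x 1 ≤ x 0) (h12 : x 2 ≤ x 1) (h2 : 0 ≤ x 2)
    (π : Equiv.Perm (Fin 3 × Fin n)) : 0 ≤ ∑ p, f (π p) * ptEigenvalue x p := by
  have hpt : (fun p : Fin 3 × Fin n => ptEigenvalue x p) = rankEigenvalue x ∘ indexRank :=
    funext fun p => ptEigenvalue_eq_rankEigenvalue x p hn
  rcases le_total (x 0 * x 2) (x 1 ^ 2) with h | h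
  · have hav : Antivary f (fun p => ptEigenvalue x p) := by
      rw [hpt]
      exact (hf.symm.comp_monotone_left (rankEigenvalue_monotone h01 h12 h2 h)).symm
    exact (hC x).1.trans (hav.sum_mul_le_sum_comp_perm_mul (σ := π))
  · have hav : Antivary (f ∘ midSwap hn) (fun p => ptEigenvalue x p) := by
      have h3 : (fun p : Fin 3 × Fin n => ptEigenvalue x p) =
          (rankEigenvalue x ∘ Equiv.swap 6 7) ∘ (indexRank ∘ midSwap hn) := by
        rw [hpt]
        ext p
        simp [indexRank_midSwap]
      rw [h3]
      refine (Antivary.comp_monotone_left ?_ (rankEigenvalue_swap_monotone h01 h12 h2 h)).symm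
      exact fun p q hpq => hf.symm hpq
    have := (hC x).2.trans
      (hav.sum_mul_le_sum_comp_perm_mul (σ := π.trans (midSwap hn)))
    simpa [midSwap] using this

lemma sum_eq_one_of_trace {ι : Type*} [Fintype ι] [DecidableEq ι] {U : Matrix ι ι ℂ}
    (hU : U ∈ unitaryGroup ι ℂ) {f : ι → ℝ} :
    (U * realDiagonal f * Uᴴ).trace = ((∑ p, f p : ℝ) : ℂ) := by
  have : Uᴴ * U = 1 := mem_unitaryGroup_iff'.1 hU
  rw [trace_mul_comm, ← Matrix.mul_assoc, this, Matrix.one_mul, realDiagonal, trace_diagonal]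
  simp

lemma diagForm_single (f : Fin 3 × Fin n → ℝ) (hn : 3 ≤ n) :
    diagForm f ![1, 0, 0] = f (0, Fin.castLE hn 0) := by
  simp [diagForm_eq hn]

/-- The coefficient of x₀² sits at the top rank and is therefore the smallest eigenvalue. -/
lemma nonneg_of_formsNonneg (hn : 3 ≤ n) {f : Fin 3 × Fin n → ℝ} (hf : Antivary f indexRank)
    (hC : FormsNonneg hn f) (p : Fin 3 × Fin n) : 0 ≤ f p := by
  have h0 := (hC ![1, 0, 0]).1
  rw [diagForm_single f hn] at h0
  by_cases hp : p = (0, Fin.castLE hn 0)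
  · rwa [hp]
  refine h0.trans (hf ?_)
  rcases index_cases hn p with h | ⟨i, j, rfl⟩
  · rw [indexRank_of_le h, indexRank_castLE]; decide
  · rw [indexRank_castLE, indexRank_castLE]
    have : ¬ (i = 0 ∧ j = 0) := by rintro ⟨rfl, rfl⟩; exact hp rfl
    clear hp
    revert i j; decide

lemma conj_mem_AP (hn : 3 ≤ n) {f : Fin 3 × Fin n → ℝ} (hf : Antivary f indexRank)
    (hC : FormsNonneg hn f) (h1 : ∑ p, f p = 1)
    {U : Matrix (Fin 3 × Fin n) (Fin 3 × Fin n) ℂ} (hU : U ∈ unitaryGroup (Fin 3 × Fin n) ℂ) :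
    U * realDiagonal f * Uᴴ ∈ AP 3 n := by
  refine mem_AP_of_diagForm_nonneg hn ⟨?_, ?_⟩ fun W hW x h01 h12 h2 => ?_
  · refine PosSemidef.mul_mul_conjTranspose_same (PosSemidef.diagonal fun p => ?_) U
    exact Complex.zero_le_real.2 (nonneg_of_formsNonneg hn hf hC p)
  · rw [sum_eq_one_of_trace hU, h1]; simp
  · have e : W * (U * realDiagonal f * Uᴴ) * Wᴴ = (W * U) * realDiagonal f * (W * U)ᴴ := by
      simp only [conjTranspose_mul, Matrix.mul_assoc]
    rw [e]
    exact sum_diagRe_mul_nonneg_of_perm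
      (fun π => diagForm_perm_nonneg hn hf hC h01 h12 h2 π) (mul_mem hW hU)

lemma exists_sorted_of_mem_AP {ρ : Matrix (Fin 3 × Fin n) (Fin 3 × Fin n) ℂ} (hρ : ρ ∈ AP 3 n) :
    ∃ U ∈ unitaryGroup (Fin 3 × Fin n) ℂ, ∃ f : Fin 3 × Fin n → ℝ,
      ρ = U * realDiagonal f * Uᴴ ∧ Antivary f indexRank :=
  exists_sorted_diagonalization hρ.1.1.1 _

lemma conj_conj_star {ι : Type*} [Fintype ι] [DecidableEq ι] {U : Matrix ι ι ℂ}
    (hU : U ∈ unitaryGroup ι ℂ) (M : Matrix ι ι ℂ) : Uᴴ * (U * M * Uᴴ) * U = M := by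
  have : Uᴴ * U = 1 := mem_unitaryGroup_iff'.1 hU
  calc _ = (Uᴴ * U) * M * (Uᴴ * U) := by simp only [Matrix.mul_assoc]
    _ = M := by rw [this]; simp

lemma AP_sum_eq_one {U : Matrix (Fin 3 × Fin n) (Fin 3 × Fin n) ℂ}
    (hU : U ∈ unitaryGroup (Fin 3 × Fin n) ℂ) {f : Fin 3 × Fin n → ℝ}
    (h : U * realDiagonal f * Uᴴ ∈ AP 3 n) : ∑ p, f p = 1 := by
  have := h.1.2
  rw [sum_eq_one_of_trace hU] at this
  exact_mod_cast this

/-- Permutations are unitary, so every rearrangement of the spectrum gives a nonnegative form; the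
identity and `midSwap` give the two required. -/
lemma formsNonneg_of_mem_AP (hn : 3 ≤ n) {U : Matrix (Fin 3 × Fin n) (Fin 3 × Fin n) ℂ}
    (hU : U ∈ unitaryGroup (Fin 3 × Fin n) ℂ) {f : Fin 3 × Fin n → ℝ}
    (h : U * realDiagonal f * Uᴴ ∈ AP 3 n) : FormsNonneg hn f := by
  have key : ∀ π : Equiv.Perm (Fin 3 × Fin n), ∀ x, 0 ≤ diagForm (f ∘ π) x := by
    intro π x
    obtain ⟨P, hP, hd⟩ := conj_realDiagonal_comp_perm π f
    have := diagForm_nonneg_of_mem_AP hn h (mul_mem hP (Unitary.star_mem hU)) x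
    rw [star_eq_conjTranspose] at this
    have e : P * Uᴴ * (U * realDiagonal f * Uᴴ) * (P * Uᴴ)ᴴ = realDiagonal (f ∘ π) := by
      rw [hd, conjTranspose_mul, conjTranspose_conjTranspose]
      calc _ = P * (Uᴴ * (U * realDiagonal f * Uᴴ) * U) * Pᴴ := by simp only [Matrix.mul_assoc]
        _ = _ := by rw [conj_conj_star hU]
    rw [e] at this
    have e2 : diagRe (realDiagonal (f ∘ π)) = f ∘ π := by
      ext p; simp [diagRe, realDiagonal]
    rwa [e2] at this
  exact fun x => ⟨key 1 x, key _ x⟩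

end Rearrangement

/-! ### Gradients of the quadratic forms -/

section Polarization

variable {n : ℕ}

/-- Polarization of `ptEigenvalue`. -/
def ptBilin (x y : Fin 3 → ℝ) (p : Fin 3 × Fin n) : ℝ :=
  (if (p.2 : ℕ) < p.1 then -1 else 1) *
    (x p.1 * extendZero y p.2 + y p.1 * extendZero x p.2)

lemma ptEigenvalue_add_smul (x y : Fin 3 → ℝ) (t : ℝ) (p : Fin 3 × Fin n) :
    ptEigenvalue (x + t • y) p =
      ptEigenvalue x p + t * ptBilin x y p + t ^ 2 * ptEigenvalue y p := by
  unfold ptEigenvalue ptBilin extendZero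
  split_ifs <;> simp <;> ring

lemma sum_ptBilin_eq (hn : 3 ≤ n) (d : Fin 3 × Fin n → ℝ) (x y : Fin 3 → ℝ) :
    ∑ p, d p * ptBilin x y p =
      2 * d (0, Fin.castLE hn 0) * (x 0 * y 0) + 2 * d (1, Fin.castLE hn 1) * (x 1 * y 1) +
      2 * d (2, Fin.castLE hn 2) * (x 2 * y 2) +
      (d (0, Fin.castLE hn 1) - d (1, Fin.castLE hn 0)) * (x 0 * y 1 + x 1 * y 0) +
      (d (0, Fin.castLE hn 2) - d (2, Fin.castLE hn 0)) * (x 0 * y 2 + x 2 * y 0) +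
      (d (1, Fin.castLE hn 2) - d (2, Fin.castLE hn 1)) * (x 1 * y 2 + x 2 * y 1) := by
  rw [Fintype.sum_prod_type]
  have : ∀ i : Fin 3, ∑ j : Fin n, d (i, j) * ptBilin x y (i, j) =
      ∑ j : Fin 3, d (i, Fin.castLE hn j) * ptBilin x y (i, Fin.castLE hn j) := by
    intro i
    refine sum_extendZero hn _ fun j hj => ?_
    simp [ptBilin, extendZero, not_lt.2 hj]
  simp only [this, Fin.sum_univ_three]
  simp [ptBilin, extendZero]
  ring

end Polarization

/-! ### At most seven distinct eigenvalues -/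

section Perturbation

variable {n : ℕ}

/-- If the (y, z) block were degenerate with b > 0, its null vector (−l, 2b) would have positive
entries. The negative `g` and `h` would then make the term linear in x negative along it, and a
small x > 0 would violate nonnegativity. -/
lemma ternary_block_pos {a b c g h l : ℝ}
    (hQ : ∀ x y z : ℝ, 0 ≤ a * x ^ 2 + b * y ^ 2 + c * z ^ 2 + g * (x * y) + h * (x * z) + l * (y * z))
    (hg : g < 0) (hh : h < 0) (hl : l < 0) : 0 < b ∧ 0 < 4 * b * c - l ^ 2 := by
  have hb0 : 0 ≤ b := by simpa using hQ 0 1 0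
  have hc0 : 0 ≤ c := by simpa using hQ 0 0 1
  have hb : 0 < b := by
    rcases hb0.lt_or_eq with hb | hb
    · exact hb
    · have := hQ 0 ((c + 1) / (-l)) 1
      have e : l * ((c + 1) / -l) = -(c + 1) := by
        rw [div_neg, mul_neg, mul_div_cancel₀ _ hl.ne]
      rw [← hb] at this
      nlinarith
  refine ⟨hb, ?_⟩
  have hD : 0 ≤ 4 * b * c - l ^ 2 := by
    have := hQ 0 (-l) (2 * b)
    by_contra! hneg
    nlinarith
  rcases hD.lt_or_eq with hD | hD
  · exact hD
  · exfalso
    set m := g * (-l) + h * (2 * b) with hm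
    have hmneg : m < 0 := by nlinarith
    have key : ∀ s : ℝ, 0 ≤ a * s ^ 2 + s * m := by
      intro s
      have := hQ s (-l) (2 * b)
      have e : b * (-l) ^ 2 + c * (2 * b) ^ 2 + l * (-l * (2 * b)) = 0 := by
        linear_combination (-b) * hD
      nlinarith
    have ha : 0 ≤ a := by simpa using hQ 1 0 0
    -- The `+ 1` keeps the denominator positive even when `a` vanishes.
    have hs := key (-m / (2 * (a + 1)))
    have e : a * (-m / (2 * (a + 1))) ^ 2 + (-m / (2 * (a + 1))) * m =
        m ^ 2 * (-(a + 2)) / (4 * (a + 1) ^ 2) := by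
      field_simp; ring
    rw [e] at hs
    have : m ^ 2 * (-(a + 2)) / (4 * (a + 1) ^ 2) < 0 := by
      apply div_neg_of_neg_of_pos
      · nlinarith [pow_pos (neg_pos.2 hmneg) 2]
      · positivity
    linarith

/-- Cramer's rule for the point (1, u, v) where the form restricted to the plane x = 1 is critical.
-/
lemma ternary_exists_critical {b c g h l : ℝ} (hD : 0 < 4 * b * c - l ^ 2) :
    ∃ u v : ℝ, g + 2 * b * u + l * v = 0 ∧ h + l * u + 2 * c * v = 0 := by
  have e := mul_inv_cancel₀ hD.ne'
  refine ⟨(l * h - 2 * c * g) * (4 * b * c - l ^ 2)⁻¹, (l * g - 2 * b * h) * (4 * b * c - l ^ 2)⁻¹,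
    ?_, ?_⟩
  · linear_combination (-g) * e
  · linear_combination (-h) * e

/-- A perturbation of a positive semidefinite ternary form that preserves the critical direction
remains positive semidefinite. -/
lemma ternary_perturb {a b c g h l a' b' c' g' h' l' u v : ℝ}
    (hQ : ∀ x y z : ℝ, 0 ≤ a * x ^ 2 + b * y ^ 2 + c * z ^ 2 + g * (x * y) + h * (x * z) + l * (y * z))
    (hb : 0 < b) (hD : 0 < 4 * b * c - l ^ 2)
    (h1 : g + 2 * b * u + l * v = 0) (h2 : h + l * u + 2 * c * v = 0)
    (h0' : 2 * a' + g' * u + h' * v = 0) (h1' : g' + 2 * b' * u + l' * v = 0)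
    (h2' : h' + l' * u + 2 * c' * v = 0) :
    ∀ᶠ t : ℝ in nhds 0, ∀ x y z : ℝ, 0 ≤ (a + t * a') * x ^ 2 + (b + t * b') * y ^ 2 +
      (c + t * c') * z ^ 2 + (g + t * g') * (x * y) + (h + t * h') * (x * z) +
      (l + t * l') * (y * z) := by
  have e1 : ∀ᶠ t : ℝ in nhds 0, 0 < b + t * b' :=
    ContinuousAt.eventually_lt (f := fun _ => (0 : ℝ)) (by fun_prop) (by fun_prop) (by simpa using hb)
  have e2 : ∀ᶠ t : ℝ in nhds 0, 0 < 4 * (b + t * b') * (c + t * c') - (l + t * l') ^ 2 :=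
    ContinuousAt.eventually_lt (f := fun _ => (0 : ℝ)) (by fun_prop) (by fun_prop) (by simpa using hD)
  filter_upwards [e1, e2] with t ht1 ht2 x y z
  have hk := hQ 1 u v
  set B := b + t * b'
  set C := c + t * c'
  set L := l + t * l'
  -- Subtracting x·(1, u, v) splits the perturbed form into its value at (1, u, v) times x² plus the
  -- perturbed block in `Y`, `Z`. The gradient conditions keep that value equal to the unperturbed
  -- one.
  set Y := y - u * x
  set Z := z - v * x
  have hblock : 0 ≤ B * Y ^ 2 + C * Z ^ 2 + L * (Y * Z) := by
    have : 0 ≤ 4 * B * (B * Y ^ 2 + C * Z ^ 2 + L * (Y * Z)) := by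
      have : 4 * B * (B * Y ^ 2 + C * Z ^ 2 + L * (Y * Z)) =
        (2 * B * Y + L * Z) ^ 2 + (4 * B * C - L ^ 2) * Z ^ 2 := by ring
      rw [this]; positivity
    exact nonneg_of_mul_nonneg_right this (by positivity)
  have e : (a + t * a') * x ^ 2 + B * y ^ 2 + C * z ^ 2 + (g + t * g') * (x * y) +
      (h + t * h') * (x * z) + L * (y * z) =
      (a * 1 ^ 2 + b * u ^ 2 + c * v ^ 2 + g * (1 * u) + h * (1 * v) + l * (u * v)) * x ^ 2 +
      (B * Y ^ 2 + C * Z ^ 2 + L * (Y * Z)) := by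
    simp only [B, C, L, Y, Z]
    linear_combination (x * y - u * x ^ 2) * (h1 + t * h1') + (x * z - v * x ^ 2) * (h2 + t * h2')
      + (x ^ 2 * t / 2) * (h0' + u * h1' + v * h2')
  rw [e]
  positivity

/-- If `f` takes more than `m` values, then `m` linear conditions leave a nonzero direction that is
constant on the level sets of `f`. -/
lemma exists_levelset_direction {ι : Type*} [Fintype ι] {m : ℕ} (f : ι → ℝ)
    (hf : m < (Finset.univ.image f).card) (c : Fin m → ι → ℝ) :
    ∃ w : ℝ → ℝ, (∃ p, w (f p) ≠ 0) ∧ ∀ i, ∑ p, w (f p) * c i p = 0 := by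
  classical
  let S := Finset.univ.image f
  have hS : ∀ p, f p ∈ S := fun p => Finset.mem_image_of_mem _ (Finset.mem_univ _)
  let Φ : (S → ℝ) →ₗ[ℝ] (Fin m → ℝ) :=
    { toFun := fun w i => ∑ p, w ⟨f p, hS p⟩ * c i p
      map_add' := fun w w' => by ext i; simp [add_mul, Finset.sum_add_distrib]
      map_smul' := fun r w => by ext i; simp [Finset.mul_sum, mul_assoc] }
  have hk : LinearMap.ker Φ ≠ ⊥ := LinearMap.ker_ne_bot_of_finrank_lt (by simpa using hf)
  obtain ⟨w, hw, hw0⟩ := Submodule.exists_mem_ne_zero_of_ne_bot hk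
  refine ⟨fun r => if h : r ∈ S then w ⟨r, h⟩ else 0, ?_, fun i => ?_⟩
  · by_contra! hall
    apply hw0
    ext ⟨r, hr⟩
    obtain ⟨p, -, rfl⟩ := Finset.mem_image.1 hr
    simpa [hS p] using hall p
  · have := congrFun (LinearMap.mem_ker.1 hw) i
    simpa [Φ, hS] using this

lemma eq_of_realDiagonal_conj {ι : Type*} [Fintype ι] [DecidableEq ι] {U : Matrix ι ι ℂ}
    (hU : U ∈ unitaryGroup ι ℂ) {f g : ι → ℝ}
    (h : U * realDiagonal f * Uᴴ = U * realDiagonal g * Uᴴ) : f = g := by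
  have := congrArg (fun M => Uᴴ * M * U) h
  simp only [conj_conj_star hU] at this
  ext p
  have := congrFun (congrFun this p) p
  simpa [realDiagonal] using this

lemma realDiagonal_conj_comb {ι : Type*} [Fintype ι] [DecidableEq ι] (U : Matrix ι ι ℂ) (s t : ℝ)
    (f g : ι → ℝ) : U * realDiagonal (s • f + t • g) * Uᴴ =
      s • (U * realDiagonal f * Uᴴ) + t • (U * realDiagonal g * Uᴴ) := by
  have : realDiagonal (s • f + t • g) = s • realDiagonal f + t • realDiagonal g := by
    ext i j
    by_cases h : i = j <;> simp [realDiagonal, h]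
  rw [this, Matrix.mul_add, Matrix.add_mul]
  simp

/-- Otherwise all eigenvalues of ranks 2 to 5 coincide, including the whole rank 3 class, and only
the seven values at ranks 0, 1, 2, 6, 7, 8, 9 remain. -/
lemma sorted_mid_lt (hn : 3 ≤ n) {f : Fin 3 × Fin n → ℝ} (hf : Antivary f indexRank)
    (hc : 7 < (Finset.univ.image f).card) :
    f (1, Fin.castLE hn 2) < f (2, Fin.castLE hn 1) := by
  by_contra! hle
  have hsub : Finset.univ.image f ⊆ Finset.univ.image (fun i : Fin 7 => f
      (![(1, Fin.castLE hn 0), (2, Fin.castLE hn 0), (2, Fin.castLE hn 1), (0, Fin.castLE hn 2),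
        (1, Fin.castLE hn 1), (0, Fin.castLE hn 1), (0, Fin.castLE hn 0)] i)) := by
    intro r hr
    obtain ⟨p, -, rfl⟩ := Finset.mem_image.1 hr
    have hmid : indexRank (2, Fin.castLE hn 1) < indexRank p →
        indexRank p < indexRank (1, Fin.castLE hn 2) → f (2, Fin.castLE hn 1) = f p :=
      fun h1 h2 => le_antisymm (hle.trans (hf h2)) (hf h1)
    have hend : f (2, Fin.castLE hn 1) = f (1, Fin.castLE hn 2) :=
      le_antisymm hle (hf (by rw [indexRank_castLE, indexRank_castLE]; decide))
    rw [indexRank_castLE, indexRank_castLE] at hmid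
    simp only [Finset.mem_image, Finset.mem_univ, true_and]
    rcases index_cases hn p with h | ⟨i, j, rfl⟩
    · rw [indexRank_of_le h] at hmid
      exact ⟨2, hmid (by decide) (by decide)⟩
    · rw [indexRank_castLE] at hmid
      fin_cases i <;> fin_cases j
      exacts [⟨6, rfl⟩, ⟨5, rfl⟩, ⟨3, rfl⟩, ⟨0, rfl⟩, ⟨4, rfl⟩, ⟨2, hend⟩, ⟨1, rfl⟩, ⟨2, rfl⟩,
        ⟨2, hmid (by decide) (by decide)⟩]
  have := (Finset.card_le_card hsub).trans Finset.card_image_le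
  simp at this
  omega

/-- Quantitative core of the bound on the number of distinct eigenvalues. -/
theorem extreme_card_le_seven (hn : 3 ≤ n) {f : Fin 3 × Fin n → ℝ} (hf : Antivary f indexRank)
    {U : Matrix (Fin 3 × Fin n) (Fin 3 × Fin n) ℂ} (hU : U ∈ unitaryGroup (Fin 3 × Fin n) ℂ)
    (hρ : U * realDiagonal f * Uᴴ ∈ (AP 3 n).extremePoints ℝ) :
    (Finset.univ.image f).card ≤ 7 := by
  by_contra! hc
  have hC := formsNonneg_of_mem_AP hn hU hρ.1
  have h1 := AP_sum_eq_one hU hρ.1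
  have hmid := sorted_mid_lt hn hf hc
  have hr : ∀ i j k l : Fin 3, ![![9, 8, 6], ![0, 7, 5], ![1, 2, 4]] i j <
      ![![9, 8, 6], ![0, 7, 5], ![1, 2, 4]] k l →
      f (k, Fin.castLE hn l) ≤ f (i, Fin.castLE hn j) := by
    intro i j k l h
    apply hf
    rw [indexRank_castLE, indexRank_castLE]
    exact h
  -- Every mixed coefficient subtracts an eigenvalue of rank at most 2 from one of rank at least 5,
  -- so the strict drop between ranks 2 and 5 makes all of them negative.
  have r1 := hr 1 2 0 1 (by decide)
  have r2 := hr 1 2 0 2 (by decide)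
  have r3 := hr 1 2 1 1 (by decide)
  have r4 := hr 1 0 2 1 (by decide)
  have r5 := hr 2 0 2 1 (by decide)
  have hms : ∀ d : Fin 3 × Fin n → ℝ,
      (d ∘ midSwap hn) (0, Fin.castLE hn 0) = d (0, Fin.castLE hn 0) ∧
      (d ∘ midSwap hn) (1, Fin.castLE hn 1) = d (0, Fin.castLE hn 2) ∧
      (d ∘ midSwap hn) (2, Fin.castLE hn 2) = d (2, Fin.castLE hn 2) ∧
      (d ∘ midSwap hn) (0, Fin.castLE hn 1) = d (0, Fin.castLE hn 1) ∧
      (d ∘ midSwap hn) (1, Fin.castLE hn 0) = d (1, Fin.castLE hn 0) ∧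
      (d ∘ midSwap hn) (0, Fin.castLE hn 2) = d (1, Fin.castLE hn 1) ∧
      (d ∘ midSwap hn) (2, Fin.castLE hn 0) = d (2, Fin.castLE hn 0) ∧
      (d ∘ midSwap hn) (1, Fin.castLE hn 2) = d (1, Fin.castLE hn 2) ∧
      (d ∘ midSwap hn) (2, Fin.castLE hn 1) = d (2, Fin.castLE hn 1) := by
    intro d
    simp [midSwap, Equiv.swap_apply_def]
  obtain ⟨m1, m2, m3, m4, m5, m6, m7, m8, m9⟩ := hms f
  -- For either form, vanishing of the gradient of `d'` at the critical vector `k` is enough to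
  -- perturb along `d'`.
  have core : ∀ d : Fin 3 × Fin n → ℝ, (∀ x, 0 ≤ diagForm d x) →
      d (0, Fin.castLE hn 1) - d (1, Fin.castLE hn 0) < 0 →
      d (0, Fin.castLE hn 2) - d (2, Fin.castLE hn 0) < 0 →
      d (1, Fin.castLE hn 2) - d (2, Fin.castLE hn 1) < 0 →
      ∃ k : Fin 3 → ℝ, ∀ d' : Fin 3 × Fin n → ℝ,
        (∀ i, ∑ p, d' p * ptBilin k (Pi.single i 1) p = 0) →
        ∀ᶠ t : ℝ in nhds 0, ∀ x, 0 ≤ diagForm (d + t • d') x := by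
    intro d hd hg hh hl
    have hQ : ∀ x y z : ℝ, 0 ≤ d (0, Fin.castLE hn 0) * x ^ 2 + d (1, Fin.castLE hn 1) * y ^ 2 +
      d (2, Fin.castLE hn 2) * z ^ 2 +
      (d (0, Fin.castLE hn 1) - d (1, Fin.castLE hn 0)) * (x * y) +
      (d (0, Fin.castLE hn 2) - d (2, Fin.castLE hn 0)) * (x * z) +
      (d (1, Fin.castLE hn 2) - d (2, Fin.castLE hn 1)) * (y * z) := by
      intro x y z
      simpa [diagForm_eq hn] using hd ![x, y, z]
    obtain ⟨hb, hD⟩ := ternary_block_pos hQ hg hh hl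
    obtain ⟨u, v, k1, k2⟩ := ternary_exists_critical (g := d (0, Fin.castLE hn 1) -
      d (1, Fin.castLE hn 0)) (h := d (0, Fin.castLE hn 2) - d (2, Fin.castLE hn 0)) hD
    refine ⟨![1, u, v], fun d' hd' => ?_⟩
    have i0 := hd' 0
    have i1 := hd' 1
    have i2 := hd' 2
    rw [sum_ptBilin_eq hn] at i0 i1 i2
    simp at i0 i1 i2
    filter_upwards [ternary_perturb (a' := d' (0, Fin.castLE hn 0)) (b' := d' (1, Fin.castLE hn 1))
      (c' := d' (2, Fin.castLE hn 2)) (g' := d' (0, Fin.castLE hn 1) - d' (1, Fin.castLE hn 0))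
      (h' := d' (0, Fin.castLE hn 2) - d' (2, Fin.castLE hn 0))
      (l' := d' (1, Fin.castLE hn 2) - d' (2, Fin.castLE hn 1)) hQ hb hD k1 k2
      (by linarith) (by linarith) (by linarith)]
      with t ht x
    have := ht (x 0) (x 1) (x 2)
    rw [diagForm_eq hn]
    simp only [Pi.add_apply, Pi.smul_apply, smul_eq_mul]
    convert this using 1
    ring
  obtain ⟨k, hk⟩ := core f (fun x => (hC x).1) (by linarith) (by linarith) (by linarith)
  obtain ⟨k', hk'⟩ := core (f ∘ midSwap hn) (fun x => (hC x).2) (by rw [m4, m5]; linarith)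
    (by rw [m6, m7]; linarith) (by rw [m8, m9]; linarith)
  -- Seven conditions: trace zero, and three gradient equations for each form, those of the second
  -- pulled back through `midSwap`.
  obtain ⟨w, ⟨p₀, hp₀⟩, hw⟩ := exists_levelset_direction f hc
    ![fun _ => 1, ptBilin k (Pi.single 0 1), ptBilin k (Pi.single 1 1), ptBilin k (Pi.single 2 1),
      ptBilin k' (Pi.single 0 1) ∘ midSwap hn, ptBilin k' (Pi.single 1 1) ∘ midSwap hn,
      ptBilin k' (Pi.single 2 1) ∘ midSwap hn]
  set v : Fin 3 × Fin n → ℝ := fun p => w (f p) with hv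
  have hsum : ∑ p, v p = 0 := by simpa using hw 0
  have ev1 := hk v (by
    intro i
    fin_cases i
    exacts [hw 1, hw 2, hw 3])
  have hshift : ∀ c : Fin 3 × Fin n → ℝ, ∑ p, (v ∘ midSwap hn) p * c p =
      ∑ p, v p * (c ∘ midSwap hn) p := by
    intro c
    rw [← Equiv.sum_comp (midSwap hn)]
    simp [midSwap]
  have ev2 := hk' (v ∘ midSwap hn) (by
    intro i
    rw [hshift]
    fin_cases i
    exacts [hw 4, hw 5, hw 6])
  -- Since `v` is a function of `f`, equal eigenvalues stay equal, and strict inequalities persist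
  -- for small `t`; the ordering survives.
  have ev3 : ∀ᶠ t : ℝ in nhds 0, Antivary (f + t • v) indexRank := by
    have : ∀ p q, ∀ᶠ t : ℝ in nhds 0, indexRank p < indexRank q → (f + t • v) q ≤ (f + t • v) p := by
      intro p q
      by_cases hpq : indexRank p < indexRank q
      · rcases (hf hpq).lt_or_eq with h | h
        · have : ∀ᶠ t : ℝ in nhds 0, f q + t * v q < f p + t * v p :=
            ContinuousAt.eventually_lt (by fun_prop) (by fun_prop) (by simpa using h)
          filter_upwards [this] with t ht _
          simpa using ht.le
        · refine Filter.Eventually.of_forall fun t _ => ?_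
          simp [hv, h]
      · exact Filter.Eventually.of_forall fun t h => absurd h hpq
    filter_upwards [Filter.eventually_all.2 fun p => Filter.eventually_all.2 (this p)]
      with t ht p q h using ht p q h
  have ev : ∀ᶠ t : ℝ in nhds 0, U * realDiagonal (f + t • v) * Uᴴ ∈ AP 3 n := by
    filter_upwards [ev1, ev2, ev3] with t t1 t2 t3
    refine conj_mem_AP hn t3 (fun x => ⟨t1 x, t2 x⟩) ?_ hU
    simp [Finset.sum_add_distrib, ← Finset.mul_sum, h1, hsum]
  have evneg : ∀ᶠ t : ℝ in nhds 0, U * realDiagonal (f + (-t) • v) * Uᴴ ∈ AP 3 n := by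
    have : Filter.Tendsto (fun t : ℝ => -t) (nhds 0) (nhds 0) := by
      simpa using (continuous_neg (G := ℝ)).tendsto 0
    exact this.eventually ev
  obtain ⟨t, ⟨htp, htn⟩, ht0⟩ := (((ev.and evneg).filter_mono nhdsWithin_le_nhds).and
    (self_mem_nhdsWithin (a := (0 : ℝ)) (s := Set.Ioi 0))).exists
  have hseg : U * realDiagonal f * Uᴴ ∈ openSegment ℝ (U * realDiagonal (f + t • v) * Uᴴ)
      (U * realDiagonal (f + (-t) • v) * Uᴴ) := by
    refine ⟨1 / 2, 1 / 2, by norm_num, by norm_num, by norm_num, ?_⟩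
    rw [← realDiagonal_conj_comb]
    congr 3
    ext p
    simp
    ring
  have heq := congrFun (eq_of_realDiagonal_conj hU (hρ.2 htp htn hseg)) p₀
  have ht0' : (0 : ℝ) < t := ht0
  simp [hv, ht0'.ne', hp₀] at heq

/-- Every extreme point of `AP 3 n` has at most seven distinct eigenvalues. -/
theorem extreme_spectrum_encard_le (n : ℕ) (ρ : Matrix (Fin 3 × Fin n) (Fin 3 × Fin n) ℂ)
    (hρ : ρ ∈ (AP 3 n).extremePoints ℝ) : (spectrum ℂ ρ).encard ≤ 7 := by
  obtain ⟨U, hU, f, rfl, hf⟩ := exists_sorted_of_mem_AP hρ.1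
  rw [spectrum_unitary_conj hU]
  refine (Set.encard_image_le _ _).trans ?_
  have e : Set.range f = ((Finset.univ.image f : Finset ℝ) : Set ℝ) := by simp
  rw [e, Set.encard_coe_eq_coe_finsetCard]
  have : (Finset.univ.image f).card ≤ 7 := by
    by_cases hn : 3 ≤ n
    · exact extreme_card_le_seven hn hf hU hρ
    -- For n ≤ 2 the matrix has order 3n ≤ 6.
    · refine Finset.card_image_le.trans ?_
      simp
      omega
  exact_mod_cast this

end Perturbation

/-! ### Rotations in a coordinate plane -/

section PlaneRotation

variable {ι : Type*} [Fintype ι] [DecidableEq ι]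

/-- The unitary acting as `[[c, -s z̄], [s z, c]]` on the coordinates `p`, `q` and trivially on the
others. -/
noncomputable def planeRotation (p q : ι) (c s : ℝ) (z : ℂ) : Matrix ι ι ℂ :=
  Matrix.of fun i j =>
    if i = p then (if j = p then (c : ℂ) else 0) + (if j = q then -(s * star z) else 0)
    else if i = q then (if j = p then s * z else 0) + (if j = q then (c : ℂ) else 0)
    else if j = i then 1 else 0

lemma planeRotation_mul_apply (p q : ι) (c s : ℝ) (z : ℂ) (M : Matrix ι ι ℂ) (i j : ι) :
    (planeRotation p q c s z * M) i j =
      if i = p then c * M p j - s * star z * M q j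
      else if i = q then s * z * M p j + c * M q j else M i j := by
  rw [Matrix.mul_apply]
  split_ifs with h1 h2
  · simp [planeRotation, h1, add_mul, Finset.sum_add_distrib, sub_eq_add_neg]
  · simp [planeRotation, h2, add_mul, Finset.sum_add_distrib]
    simp [← h2, h1]
  · simp [planeRotation, h1, h2]

lemma mul_planeRotation_apply (p q : ι) (c s : ℝ) (z : ℂ) (M : Matrix ι ι ℂ) (i j : ι) :
    (M * (planeRotation p q c s z)ᴴ) i j =
      if j = p then c * M i p - s * z * M i q
      else if j = q then s * star z * M i p + c * M i q else M i j := by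
  have : M * (planeRotation p q c s z)ᴴ = (planeRotation p q c s z * Mᴴ)ᴴ := by
    rw [conjTranspose_mul, conjTranspose_conjTranspose]
  rw [this, conjTranspose_apply, planeRotation_mul_apply]
  split_ifs <;> simp

lemma planeRotation_mem_unitaryGroup {p q : ι} (hpq : p ≠ q) {c s : ℝ} (hcs : c ^ 2 + s ^ 2 = 1)
    {z : ℂ} (hz : z * star z = 1) : planeRotation p q c s z ∈ unitaryGroup ι ℂ := by
  rw [mem_unitaryGroup_iff, star_eq_conjTranspose]
  ext i j
  have hcs' : (c : ℂ) ^ 2 + (s : ℂ) ^ 2 = 1 := by exact_mod_cast hcs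
  rw [mul_planeRotation_apply]
  by_cases hi : i = p
  · subst hi
    by_cases hj : j = i
    · subst hj
      simp only [planeRotation, of_apply, if_true, if_neg hpq, if_neg hpq.symm, one_apply_eq]
      linear_combination hcs' + (s : ℂ) ^ 2 * hz
    · by_cases hj' : j = q
      · subst hj'
        simp only [planeRotation, of_apply, if_true, if_neg hpq, if_neg hpq.symm,
          one_apply_ne hpq]
        ring
      · simp [planeRotation, hj, hj', one_apply_ne (Ne.symm hj)]
  · by_cases hi' : i = q
    · subst hi'
      by_cases hj : j = p
      · subst hj
        simp only [planeRotation, of_apply, if_true, if_neg hpq, if_neg hpq.symm,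
          one_apply_ne hpq.symm]
        ring
      · by_cases hj' : j = i
        · subst hj'
          simp only [planeRotation, of_apply, if_true, if_neg hpq, if_neg hpq.symm, one_apply_eq]
          linear_combination hcs' + (s : ℂ) ^ 2 * hz
        · simp [planeRotation, hj, hj', hi, one_apply_ne (Ne.symm hj')]
    · by_cases hj : j = p
      · subst hj
        simp [planeRotation, hi, hi', Ne.symm hi, Ne.symm hi']
      · by_cases hj' : j = q
        · subst hj'
          simp [planeRotation, hi, hi', Ne.symm hi, Ne.symm hi', hj]
        · simp [planeRotation, hi, hi', hj, hj', one_apply, eq_comm (a := i)]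

lemma planeRotation_conj_realDiagonal {p q : ι} (hpq : p ≠ q) {c s : ℝ} (hcs : c ^ 2 + s ^ 2 = 1)
    {z : ℂ} (hz : z * star z = 1) {f : ι → ℝ} (hf : f p = f q) :
    planeRotation p q c s z * realDiagonal f * (planeRotation p q c s z)ᴴ = realDiagonal f := by
  have hcomm : planeRotation p q c s z * realDiagonal f =
      realDiagonal f * planeRotation p q c s z := by
    ext i j
    rw [realDiagonal, mul_diagonal, diagonal_mul]
    by_cases hi : i = p
    · subst hi
      by_cases hj : j = i
      · subst hj; ring
      · by_cases hj' : j = q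
        · subst hj'; rw [hf]; ring
        · simp [planeRotation, hj, hj']
    · by_cases hi' : i = q
      · subst hi'
        by_cases hj : j = p
        · subst hj; rw [hf]; ring
        · by_cases hj' : j = i
          · subst hj'; ring
          · simp [planeRotation, hj, hj', hi]
      · by_cases hj : j = i
        · subst hj; ring
        · simp [planeRotation, hi, hi', hj]
  have hu : planeRotation p q c s z * (planeRotation p q c s z)ᴴ = 1 :=
    mem_unitaryGroup_iff.1 (planeRotation_mem_unitaryGroup hpq hcs hz)
  rw [hcomm, Matrix.mul_assoc, hu, Matrix.mul_one]

lemma diagRe_planeRotation (p q : ι) (c s : ℝ) {z : ℂ} (hz : z * star z = 1)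
    {σ : Matrix ι ι ℂ} (hσ : σ.IsHermitian) (i : ι) :
    diagRe (planeRotation p q c s z * σ * (planeRotation p q c s z)ᴴ) i =
      if i = p then c ^ 2 * diagRe σ p + s ^ 2 * diagRe σ q - 2 * c * s * (z * σ p q).re
      else if i = q then s ^ 2 * diagRe σ p + c ^ 2 * diagRe σ q + 2 * c * s * (z * σ p q).re
      else diagRe σ i := by
  have hsym : (star z * σ q p).re = (z * σ p q).re := by
    have h : σ q p = star (σ p q) := (hσ.apply q p).symm
    rw [h, ← star_mul', Complex.star_def, Complex.conj_re]
  have e1 : (c * (c * σ p p - s * star z * σ q p) - s * z * (c * σ p q - s * star z * σ q q) : ℂ)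
      = ((c ^ 2 : ℝ) : ℂ) * σ p p + ((s ^ 2 : ℝ) : ℂ) * σ q q
        - ((c * s : ℝ) : ℂ) * (star z * σ q p) - ((c * s : ℝ) : ℂ) * (z * σ p q) := by
    push_cast
    linear_combination (s ^ 2 * σ q q : ℂ) * hz
  have e2 : (s * star z * (s * z * σ p p + c * σ q p) + c * (s * z * σ p q + c * σ q q) : ℂ)
      = ((s ^ 2 : ℝ) : ℂ) * σ p p + ((c ^ 2 : ℝ) : ℂ) * σ q q
        + ((c * s : ℝ) : ℂ) * (star z * σ q p) + ((c * s : ℝ) : ℂ) * (z * σ p q) := by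
    push_cast
    linear_combination (s ^ 2 * σ p p : ℂ) * hz
  unfold diagRe
  simp only [mul_planeRotation_apply, planeRotation_mul_apply]
  split_ifs with h1 h2
  · rw [e1]
    simp only [Complex.add_re, Complex.sub_re, Complex.re_ofReal_mul, hsym]
    ring
  · rw [e2]
    simp only [Complex.add_re, Complex.re_ofReal_mul, hsym]
    ring
  · rfl

/-- The linear term dominates near 0, and testing both `t` and `-t` excludes either sign. The shape
t(1 − t²) comes from the rational parametrization of the circle. -/
lemma linear_coeff_eq_zero {A B : ℝ} (h : ∀ t : ℝ, 0 ≤ A * t ^ 2 + B * (t * (1 - t ^ 2))) :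
    B = 0 := by
  by_contra hB
  have hB' : 0 < |B| := abs_pos.2 hB
  have key : ∀ t : ℝ, 0 < t → |B| * (1 - t ^ 2) ≤ A * t := by
    intro t ht
    have h1 := h t
    have h2 := h (-t)
    have h3 : |B| * (1 - t ^ 2) * t ≤ A * t * t := by
      rcases abs_cases B with ⟨e, -⟩ | ⟨e, -⟩ <;> rw [e] <;> nlinarith
    exact le_of_mul_le_mul_right h3 ht
  set t := |B| / (2 * (|A| + |B|)) with ht
  have hpos : 0 < 2 * (|A| + |B|) := by positivity
  have ht0 : 0 < t := by positivity
  have ht1 : t ≤ 1 / 2 := by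
    rw [ht, div_le_iff₀ hpos]; nlinarith [abs_nonneg A]
  have h4 : |A| * t ≤ |B| / 2 := by
    have : t * (2 * (|A| + |B|)) = |B| := div_mul_cancel₀ _ hpos.ne'
    nlinarith
  have h5 := key t ht0
  have h7 : t ^ 2 ≤ 1 / 4 := by nlinarith
  have h8 : |B| * t ^ 2 ≤ |B| * (1 / 4) := mul_le_mul_of_nonneg_left h7 hB'.le
  have h6 : A * t ≤ |A| * t := mul_le_mul_of_nonneg_right (le_abs_self A) ht0.le
  nlinarith

end PlaneRotation

/-! ### Rigidity of faces exposed by a zero of the form -/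

section Face

variable {n : ℕ}

/-- The value zero at `D` is a positive combination of the nonnegative values at the two endpoints,
and conjugation by `W` does not move `D`. -/
lemma diagForm_eq_zero_of_face {D σ τ : Matrix (Fin 3 × Fin n) (Fin 3 × Fin n) ℂ} (hn : 3 ≤ n)
    (hσ : σ ∈ AP 3 n) (hτ : τ ∈ AP 3 n) (hD : D ∈ openSegment ℝ σ τ) {x : Fin 3 → ℝ}
    (h0 : diagForm (diagRe D) x = 0) {W : Matrix (Fin 3 × Fin n) (Fin 3 × Fin n) ℂ}
    (hW : W ∈ unitaryGroup (Fin 3 × Fin n) ℂ) (hWD : W * D * Wᴴ = D) :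
    diagForm (diagRe (W * σ * Wᴴ)) x = 0 := by
  obtain ⟨s, t, hs, ht, -, rfl⟩ := hD
  have h1 := diagForm_nonneg_of_mem_AP hn hσ hW x
  have h2 := diagForm_nonneg_of_mem_AP hn hτ hW x
  have e : diagForm (diagRe (W * (s • σ + t • τ) * Wᴴ)) x =
      s * diagForm (diagRe (W * σ * Wᴴ)) x + t * diagForm (diagRe (W * τ * Wᴴ)) x := by
    unfold diagForm
    rw [Finset.mul_sum, Finset.mul_sum, ← Finset.sum_add_distrib]
    refine Finset.sum_congr rfl fun p _ => ?_
    simp [diagRe, Matrix.mul_add, Matrix.add_mul]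
    ring
  rw [hWD, h0] at e
  nlinarith [mul_nonneg hs.le h1, mul_nonneg ht.le h2]

lemma diagForm_add_smul (d : Fin 3 × Fin n → ℝ) (x y : Fin 3 → ℝ) (t : ℝ) :
    diagForm d (x + t • y) =
      diagForm d x + t * ∑ p, d p * ptBilin x y p + t ^ 2 * diagForm d y := by
  unfold diagForm
  rw [Finset.mul_sum, Finset.mul_sum, ← Finset.sum_add_distrib, ← Finset.sum_add_distrib]
  refine Finset.sum_congr rfl fun p _ => ?_
  rw [ptEigenvalue_add_smul]
  ring

/-- A zero of a nonnegative form is a minimum, so the derivative in every direction vanishes there.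
-/
lemma sum_ptBilin_eq_zero {d : Fin 3 × Fin n → ℝ} {x : Fin 3 → ℝ}
    (hd : ∀ y, 0 ≤ diagForm d y) (h0 : diagForm d x = 0) (y : Fin 3 → ℝ) :
    ∑ p, d p * ptBilin x y p = 0 := by
  set B := ∑ p, d p * ptBilin x y p with hB
  have hQ := hd y
  have key : ∀ t : ℝ, 0 ≤ t * B + t ^ 2 * diagForm d y := fun t => by
    have := hd (x + t • y)
    rw [diagForm_add_smul, h0, zero_add] at this
    exact this
  have := key (-B / (diagForm d y + 1))
  have hp : 0 < diagForm d y + 1 := by linarith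
  have e : -B / (diagForm d y + 1) * B + (-B / (diagForm d y + 1)) ^ 2 * diagForm d y =
      -(B ^ 2 / (diagForm d y + 1) ^ 2) := by
    field_simp; ring
  rw [e] at this
  have h2 : 0 ≤ B ^ 2 / (diagForm d y + 1) ^ 2 := by positivity
  have h3 : B ^ 2 / (diagForm d y + 1) ^ 2 = 0 := by linarith
  have h4 := (div_eq_zero_iff.1 h3).resolve_right (by positivity)
  exact pow_eq_zero_iff (two_ne_zero) |>.1 h4

lemma conj_comp {ι : Type*} [Fintype ι] (V W M : Matrix ι ι ℂ) :
    V * (W * M * Wᴴ) * Vᴴ = (V * W) * M * (V * W)ᴴ := by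
  simp only [conjTranspose_mul, Matrix.mul_assoc]

lemma diagForm_update_two {p q : Fin 3 × Fin n} (hpq : p ≠ q) {d d' : Fin 3 × Fin n → ℝ}
    (h : ∀ i, i ≠ p → i ≠ q → d' i = d i) (w : Fin 3 × Fin n → ℝ) :
    ∑ i, d' i * w i - ∑ i, d i * w i = (d' p - d p) * w p + (d' q - d q) * w q := by
  rw [← Finset.sum_sub_distrib]
  rw [← Finset.sum_subset (Finset.subset_univ {p, q}), Finset.sum_pair hpq]
  · ring
  · intro i _ hi
    simp only [Finset.mem_insert, Finset.mem_singleton, not_or] at hi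
    rw [h i hi.1 hi.2, sub_self]

/-- Description of the face of absolutely PPT states exposed at a diagonal state by a zero of its
quadratic form. -/
theorem face_rigidity (hn : 3 ≤ n) {f : Fin 3 × Fin n → ℝ} {x : Fin 3 → ℝ}
    (hgap : ∀ p q, f p ≠ f q → ptEigenvalue x p ≠ ptEigenvalue x q)
    (hnd : ∀ p q, p ≠ q → f p = f q →
      ∃ p' q', f p' = f p ∧ f q' = f p ∧ ∃ y, ptBilin x y p' ≠ ptBilin x y q')
    {σ τ : Matrix (Fin 3 × Fin n) (Fin 3 × Fin n) ℂ} (hσ : σ ∈ AP 3 n) (hτ : τ ∈ AP 3 n)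
    (hD : realDiagonal f ∈ openSegment ℝ σ τ) (h0 : diagForm f x = 0) :
    ∃ d : Fin 3 × Fin n → ℝ, σ = realDiagonal d ∧ (∀ p q, f p = f q → d p = d q) ∧
      diagForm d x = 0 ∧ ∀ y, ∑ p, d p * ptBilin x y p = 0 := by
  have hH : σ.IsHermitian := hσ.1.1.1
  have hdr : diagRe (realDiagonal f) = f := by ext p; simp [diagRe, realDiagonal]
  have hzero : ∀ W ∈ unitaryGroup (Fin 3 × Fin n) ℂ, W * realDiagonal f * Wᴴ = realDiagonal f →
      diagForm (diagRe (W * σ * Wᴴ)) x = 0 := fun W hW hWD =>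
    diagForm_eq_zero_of_face hn hσ hτ hD (by rw [hdr]; exact h0) hW hWD
  have h1 : diagForm (diagRe σ) x = 0 := by
    simpa using hzero 1 (one_mem _) (by simp)
  have hzI : ∀ z : ℂ, z = 1 ∨ z = Complex.I → z * star z = 1 := by
    rintro z (rfl | rfl) <;> simp
  have hentry : ∀ p q, (∀ z : ℂ, z = 1 ∨ z = Complex.I → (z * σ p q).re = 0) → σ p q = 0 := by
    intro p q h
    have a := h 1 (.inl rfl)
    have b := h Complex.I (.inr rfl)
    apply Complex.ext
    · simpa using a
    · simpa using b
  -- A rotation in the (p, q) plane changes the form to first order by the entry `σ p q` times the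
  -- gap in `ptEigenvalue`. The phases 1 and i give its real and imaginary parts.
  have hoff : ∀ p q, f p ≠ f q → σ p q = 0 := by
    intro p q hpq
    have hne : p ≠ q := fun h => hpq (by rw [h])
    apply hentry
    intro z hz
    set R := (z * σ p q).re with hR
    set e := ptEigenvalue x p - ptEigenvalue x q with he
    have he0 : e ≠ 0 := sub_ne_zero.2 (hgap p q hpq)
    have key : ∀ t : ℝ, 0 ≤ (-e * (diagRe σ p - diagRe σ q)) * t ^ 2 + (-e * R) * (t * (1 - t ^ 2)) := by
      intro t
      have hp : 0 < 1 + t ^ 2 := by positivity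
      -- Rational parametrization of the circle, so that positivity becomes a polynomial inequality
      -- in `t`.
      set c := (1 - t ^ 2) / (1 + t ^ 2) with hc
      set s := 2 * t / (1 + t ^ 2) with hs
      have hcs : c ^ 2 + s ^ 2 = 1 := by rw [hc, hs]; field_simp; ring
      have hV := planeRotation_mem_unitaryGroup hne hcs (hzI z hz)
      have hge := diagForm_nonneg_of_mem_AP hn hσ hV x
      have hdiff := diagForm_update_two hne (d := diagRe σ)
        (d' := diagRe (planeRotation p q c s z * σ * (planeRotation p q c s z)ᴴ))
        (fun i h1 h2 => by rw [diagRe_planeRotation p q c s (hzI z hz) hH]; simp [h1, h2])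
        (ptEigenvalue x)
      rw [diagRe_planeRotation p q c s (hzI z hz) hH, diagRe_planeRotation p q c s (hzI z hz) hH]
        at hdiff
      simp only [if_true, if_neg hne.symm] at hdiff
      change diagForm _ x - diagForm _ x = _ at hdiff
      rw [h1, sub_zero] at hdiff
      rw [hdiff] at hge
      have e1 : c ^ 2 = 1 - s ^ 2 := by linarith
      rw [e1, ← hR] at hge
      have h2 : 0 ≤ -e * (diagRe σ p - diagRe σ q) * s ^ 2 + (-e * R) * (2 * c * s) := by
        rw [he]; linarith
      have e2 : -e * (diagRe σ p - diagRe σ q) * s ^ 2 + (-e * R) * (2 * c * s) =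
          4 / (1 + t ^ 2) ^ 2 * ((-e * (diagRe σ p - diagRe σ q)) * t ^ 2 +
            (-e * R) * (t * (1 - t ^ 2))) := by
        rw [hc, hs]; field_simp; ring
      rw [e2] at h2
      exact nonneg_of_mul_nonneg_right h2 (by positivity)
    have := linear_coeff_eq_zero key
    simpa [he0] using this
  have hgrad : ∀ W ∈ unitaryGroup (Fin 3 × Fin n) ℂ, W * realDiagonal f * Wᴴ = realDiagonal f →
      ∀ y, ∑ p, diagRe (W * σ * Wᴴ) p * ptBilin x y p = 0 := fun W hW hWD =>
    sum_ptBilin_eq_zero (fun y => diagForm_nonneg_of_mem_AP hn hσ hW y) (hzero W hW hWD)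
  have hperm : ∀ π : Equiv.Perm (Fin 3 × Fin n), (∀ p, f (π p) = f p) →
      π.permMatrix ℂ * realDiagonal f * (π.permMatrix ℂ)ᴴ = realDiagonal f := by
    intro π hπ
    rw [permMatrix_conj, realDiagonal, submatrix_diagonal _ _ π.injective]
    congr 1
    ext p
    simp [hπ]
  have hswap : ∀ a b, f a = f b → ∀ p, f (Equiv.swap a b p) = f p := by
    intro a b hab p
    rw [Equiv.swap_apply_def]
    split_ifs with h1 h2
    · rw [h1, hab]
    · rw [h2, hab]
    · rfl
  have hcompu : ∀ V ∈ unitaryGroup (Fin 3 × Fin n) ℂ, V * realDiagonal f * Vᴴ = realDiagonal f →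
      ∀ π : Equiv.Perm (Fin 3 × Fin n), (∀ p, f (π p) = f p) →
      ∀ y, ∑ p, diagRe (V * σ * Vᴴ) (π p) * ptBilin x y p = 0 := by
    intro V hV hVD π hπ y
    have := hgrad (π.permMatrix ℂ * V) (mul_mem (permMatrix_mem_unitaryGroup π) hV)
      (by rw [← conj_comp, hVD, hperm π hπ]) y
    rw [← conj_comp, permMatrix_conj] at this
    exact this
  have heq : ∀ V ∈ unitaryGroup (Fin 3 × Fin n) ℂ, V * realDiagonal f * Vᴴ = realDiagonal f →
      ∀ i j, i ≠ j → f i = f j → diagRe (V * σ * Vᴴ) i = diagRe (V * σ * Vᴴ) j := by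
    intro V hV hVD i j hij hfij
    obtain ⟨p, q, hp, hq, y, hy⟩ := hnd i j hij hfij
    have hpq : p ≠ q := fun h => hy (by rw [h])
    -- `r` is chosen so that the permutation `π` below sends `p` to `i` and `q` to `j`. Comparing
    -- the gradient equations for `π` and for `π` preceded by the swap of `p` and `q` isolates the
    -- difference of the two diagonal entries.
    set r := Equiv.swap p i j with hr
    have hfr : f r = f i := by rw [hr, hswap p i hp, hfij]
    have hpr : p ≠ r := fun h => by
      have : Equiv.swap p i p = Equiv.swap p i r := by rw [← h]
      rw [Equiv.swap_apply_left, hr, Equiv.swap_apply_self] at this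
      exact hij this
    set π : Equiv.Perm (Fin 3 × Fin n) := (Equiv.swap q r).trans (Equiv.swap p i) with hπ
    have hπf : ∀ k, f (π k) = f k := fun k => by
      rw [hπ, Equiv.trans_apply, hswap p i hp, hswap q r (by rw [hq, hfr])]
    have hπp : π p = i := by
      rw [hπ, Equiv.trans_apply, Equiv.swap_apply_of_ne_of_ne hpq hpr, Equiv.swap_apply_left]
    have hπq : π q = j := by
      rw [hπ, Equiv.trans_apply, Equiv.swap_apply_left, hr, Equiv.swap_apply_self]
    have a := hcompu V hV hVD π hπf y
    have b := hcompu V hV hVD ((Equiv.swap p q).trans π)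
      (fun k => by rw [Equiv.trans_apply, hπf, hswap p q (by rw [hp, hq])]) y
    have hdiff := diagForm_update_two hpq (d := fun k => diagRe (V * σ * Vᴴ) (π k))
      (d' := fun k => diagRe (V * σ * Vᴴ) (((Equiv.swap p q).trans π) k))
      (fun k h1 h2 => by
        simp only [Equiv.trans_apply, Equiv.swap_apply_of_ne_of_ne h1 h2]) (ptBilin x y)
    rw [a, b] at hdiff
    simp only [Equiv.trans_apply, Equiv.swap_apply_left, Equiv.swap_apply_right, hπp, hπq] at hdiff
    have : (diagRe (V * σ * Vᴴ) i - diagRe (V * σ * Vᴴ) j) *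
        (ptBilin x y p - ptBilin x y q) = 0 := by linarith
    rcases mul_eq_zero.1 this with h | h
    · linarith
    · exact absurd (sub_eq_zero.1 h) hy
  have heq1 : ∀ i j, i ≠ j → f i = f j → diagRe σ i = diagRe σ j := by
    intro i j hij hfij
    simpa using heq 1 (one_mem _) (by simp) i j hij hfij
  -- The diagonal entries remain equal after any rotation inside the eigenspace. One with cs ≠ 0,
  -- such as (3/5, 4/5), forces the off-diagonal entry to vanish.
  have hin : ∀ p q, p ≠ q → f p = f q → σ p q = 0 := by
    intro p q hpq hf
    apply hentry
    intro z hz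
    have hcs : ((3 : ℝ) / 5) ^ 2 + (4 / 5) ^ 2 = 1 := by norm_num
    have := heq _ (planeRotation_mem_unitaryGroup hpq hcs (hzI z hz))
      (planeRotation_conj_realDiagonal hpq hcs (hzI z hz) hf) p q hpq hf
    rw [diagRe_planeRotation p q _ _ (hzI z hz) hH, diagRe_planeRotation p q _ _ (hzI z hz) hH]
      at this
    simp only [if_true, if_neg hpq.symm, heq1 p q hpq hf] at this
    linarith
  refine ⟨diagRe σ, ?_, ?_, h1, ?_⟩
  · ext p q
    by_cases hpq : p = q
    · subst hpq
      have := hH.apply p p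
      rw [Complex.star_def, Complex.conj_eq_iff_re] at this
      simp [realDiagonal, diagRe, this]
    · rw [realDiagonal, diagonal_apply_ne _ hpq]
      by_cases hf : f p = f q
      · exact hin p q hpq hf
      · exact hoff p q hf
  · intro p q hf
    by_cases hpq : p = q
    · rw [hpq]
    · exact heq1 p q hpq hf
  · simpa using hgrad 1 (one_mem _) (by simp)

end Face

/-! ### Unitary invariance and prescribed spectra -/

section Conjugation

lemma conj_mem_AP_of_mem {m n : ℕ} {σ U : Matrix (Fin m × Fin n) (Fin m × Fin n) ℂ}
    (hσ : σ ∈ AP m n) (hU : U ∈ unitaryGroup (Fin m × Fin n) ℂ) : U * σ * Uᴴ ∈ AP m n := by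
  have hUU : Uᴴ * U = 1 := mem_unitaryGroup_iff'.1 hU
  refine ⟨⟨hσ.1.1.mul_mul_conjTranspose_same U, ?_⟩, fun V hV => ?_⟩
  · rw [trace_mul_comm, ← Matrix.mul_assoc, hUU, Matrix.one_mul, hσ.1.2]
  · rw [conj_comp]
    exact hσ.2 _ (mul_mem hV hU)

lemma conj_mem_extremePoints {m n : ℕ} {σ U : Matrix (Fin m × Fin n) (Fin m × Fin n) ℂ}
    (hσ : σ ∈ (AP m n).extremePoints ℝ) (hU : U ∈ unitaryGroup (Fin m × Fin n) ℂ) :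
    U * σ * Uᴴ ∈ (AP m n).extremePoints ℝ := by
  have hUs : Uᴴ ∈ unitaryGroup (Fin m × Fin n) ℂ := Unitary.star_mem hU
  refine mem_extremePoints_iff_left.2 ⟨conj_mem_AP_of_mem hσ.1 hU, fun y hy z hz hseg => ?_⟩
  have hy' := conj_mem_AP_of_mem hy hUs
  have hz' := conj_mem_AP_of_mem hz hUs
  obtain ⟨s, t, hs, ht, hst, h⟩ := hseg
  have h' : σ ∈ openSegment ℝ (Uᴴ * y * Uᴴᴴ) (Uᴴ * z * Uᴴᴴ) := by
    refine ⟨s, t, hs, ht, hst, ?_⟩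
    have : Uᴴ * (s • y + t • z) * U = σ := by rw [h, conj_conj_star hU]
    rw [conjTranspose_conjTranspose, ← this]
    simp [Matrix.mul_add, Matrix.add_mul]
  have e := hσ.2 hy' hz' h'
  rw [← e, conj_comp]
  have : U * Uᴴ = 1 := mem_unitaryGroup_iff.1 hU
  simp [this]

lemma exists_perm_of_map_eq {ι : Type*} [Fintype ι] {g h : ι → ℝ}
    (H : Finset.univ.val.map g = Finset.univ.val.map h) : ∃ π : Equiv.Perm ι, g = h ∘ π := by
  classical
  have hcard : ∀ b, Fintype.card {a // g a = b} = Fintype.card {a // h a = b} := by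
    intro b
    have := congrArg (Multiset.count b) H
    rw [Multiset.count_map, Multiset.count_map] at this
    rw [Fintype.card_subtype, Fintype.card_subtype]
    simpa [Finset.card_def, eq_comm] using this
  refine ⟨Equiv.ofFiberEquiv (f := g) (g := h) fun b => Fintype.equivOfCardEq (hcard b), ?_⟩
  ext a
  exact (Equiv.ofFiberEquiv_map _ a).symm

lemma HasEigenvalueVector.exists_diagonalization {ι : Type*} [Fintype ι] [DecidableEq ι] {N : ℕ}
    {ρ : Matrix ι ι ℂ} {v : Fin N → ℝ} (hv : HasEigenvalueVector ρ v) (hρ : ρ.IsHermitian)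
    (e : ι ≃ Fin N) : ∃ U ∈ unitaryGroup ι ℂ, ρ = U * realDiagonal (v ∘ e) * Uᴴ := by
  obtain ⟨U, hU, hd⟩ := exists_unitary_diagonalization hρ
  have h := hv.2
  rw [hρ.roots_charpoly_eq_eigenvalues] at h
  have h2 : Finset.univ.val.map hρ.eigenvalues = Finset.univ.val.map v := by
    apply Multiset.map_injective Complex.ofReal_injective
    rw [Multiset.map_map, Multiset.map_map]
    exact h
  have h3 : Finset.univ.val.map hρ.eigenvalues = Finset.univ.val.map (v ∘ e) := by
    rw [h2, ← Multiset.map_map, Multiset.map_univ_val_equiv]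
  obtain ⟨π, hπ⟩ := exists_perm_of_map_eq h3
  obtain ⟨P, hP, hPd⟩ := conj_realDiagonal_comp_perm π (v ∘ e)
  refine ⟨U * P, mul_mem hU hP, ?_⟩
  rw [← conj_comp, ← hPd, ← hπ]
  exact hd

end Conjugation

/-! ### Two qutrits: boundary points with spectrum (a, b, c, …, c) -/

section Qutrits

lemma indexRank_injective : Function.Injective (indexRank (n := 3)) := by
  have : ∀ p q : Fin 3 × Fin 3, indexRank p = indexRank q → p = q := by decide
  exact fun p q => this p q

lemma indexRank_le (p : Fin 3 × Fin 3) : indexRank p ≤ 9 := by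
  revert p; decide

lemma sum_indexRank (g : ℕ → ℝ) : ∑ p : Fin 3 × Fin 3, g (indexRank p) =
    g 0 + g 1 + g 2 + g 4 + g 5 + g 6 + g 7 + g 8 + g 9 := by
  simp only [Fintype.sum_prod_type, Fin.sum_univ_three]
  change g 9 + g 8 + g 6 + (g 0 + g 7 + g 5) + (g 1 + g 2 + g 4) = _
  ring

lemma diagForm_comp_indexRank (g : ℕ → ℝ) (x : Fin 3 → ℝ) :
    diagForm (fun p : Fin 3 × Fin 3 => g (indexRank p)) x =
      g 9 * x 0 ^ 2 + g 7 * x 1 ^ 2 + g 4 * x 2 ^ 2 + (g 8 - g 0) * (x 0 * x 1) +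
      (g 6 - g 1) * (x 0 * x 2) + (g 5 - g 2) * (x 1 * x 2) := by
  rw [diagForm_eq le_rfl]
  rfl

lemma diagForm_comp_midSwap (g : ℕ → ℝ) (x : Fin 3 → ℝ) :
    diagForm ((fun p : Fin 3 × Fin 3 => g (indexRank p)) ∘ midSwap le_rfl) x =
      g 9 * x 0 ^ 2 + g 6 * x 1 ^ 2 + g 4 * x 2 ^ 2 + (g 8 - g 0) * (x 0 * x 1) +
      (g 7 - g 1) * (x 0 * x 2) + (g 5 - g 2) * (x 1 * x 2) := by
  have : (fun p : Fin 3 × Fin 3 => g (indexRank p)) ∘ midSwap le_rfl =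
      fun p => (g ∘ Equiv.swap 6 7) (indexRank p) := by
    ext p
    simp [indexRank_midSwap]
  rw [this, diagForm_comp_indexRank]
  have hs : ∀ k, k ≠ 6 → k ≠ 7 → Equiv.swap 6 7 k = k := fun k => Equiv.swap_apply_of_ne_of_ne
  simp [hs]

/-- The enumeration of the index set by increasing rank. -/
noncomputable def rankEquiv : Fin 3 × Fin 3 ≃ Fin 9 :=
  Equiv.ofBijective (fun p => ![![8, 7, 5], ![0, 6, 4], ![1, 2, 3]] p.1 p.2) (by decide)

lemma one_conj_realDiagonal {ι : Type*} [Fintype ι] [DecidableEq ι] (f : ι → ℝ) :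
    (1 : Matrix ι ι ℂ) * realDiagonal f * (1 : Matrix ι ι ℂ)ᴴ = realDiagonal f := by simp

/-- Complete the square in x and bound (py + qz)² by (p² + q²)(y² + z²). -/
lemma star_form_nonneg {c p q : ℝ} (hc : 0 < c) (h : p ^ 2 + q ^ 2 ≤ 4 * c ^ 2) (x y z : ℝ) :
    0 ≤ c * x ^ 2 + c * y ^ 2 + c * z ^ 2 - p * (x * y) - q * (x * z) := by
  have : 0 ≤ 4 * c * (c * x ^ 2 + c * y ^ 2 + c * z ^ 2 - p * (x * y) - q * (x * z)) := by
    nlinarith [sq_nonneg (2 * c * x - p * y - q * z), sq_nonneg (q * y - p * z),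
      mul_nonneg (sub_nonneg.2 h) (add_nonneg (sq_nonneg y) (sq_nonneg z))]
  exact nonneg_of_mul_nonneg_right this (by positivity)

/-- Eigenvalue profile `(a, b, c, …, c)` by rank. -/
def threeLevel (a b c : ℝ) : ℕ → ℝ
  | 0 => a
  | 1 => b
  | _ => c

lemma threeLevel_of_two_le (a b c : ℝ) {r : ℕ} (h : 2 ≤ r) : threeLevel a b c r = c := by
  match r with
  | k + 2 => rfl

lemma threeLevel_antivary {n : ℕ} {a b c : ℝ} (hab : b ≤ a) (hbc : c ≤ b) :
    Antivary (fun p : Fin 3 × Fin n => threeLevel a b c (indexRank p)) indexRank := by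
  have : Antitone (threeLevel a b c) := by
    refine antitone_nat_of_succ_le fun k => ?_
    match k with
    | 0 => exact hab
    | 1 => exact hbc
    | k + 2 => exact le_rfl
  exact fun p q h => this h.le

/-- Ranks 6 and 7 both carry `c`, so the two forms coincide and `star_form_nonneg` applies. -/
lemma threeLevel_mem_AP {a b c : ℝ} (hab : b ≤ a) (hbc : c ≤ b) (hc : 0 < c)
    (h : (a - c) ^ 2 + (b - c) ^ 2 ≤ 4 * c ^ 2) (h1 : a + b + 7 * c = 1)
    {U : Matrix (Fin 3 × Fin 3) (Fin 3 × Fin 3) ℂ} (hU : U ∈ unitaryGroup (Fin 3 × Fin 3) ℂ) :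
    U * realDiagonal (fun p => threeLevel a b c (indexRank p)) * Uᴴ ∈ AP 3 3 := by
  refine conj_mem_AP le_rfl (threeLevel_antivary hab hbc) (fun x => ?_) ?_ hU
  · rw [diagForm_comp_indexRank, diagForm_comp_midSwap]
    simp only [threeLevel]
    constructor <;> linarith [star_form_nonneg hc h (x 0) (x 1) (x 2)]
  · rw [sum_indexRank]
    simp only [threeLevel]
    linarith

/-- Boundary points with eigenvalues `(a, b, c, …, c)`, `a > b > c`, are extreme. -/
theorem boundary_three_level_extreme (ρ : Matrix (Fin 3 × Fin 3) (Fin 3 × Fin 3) ℂ) (a b c : ℝ)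
    (hρ : IsBoundaryPointAP ρ) (hab : b < a) (hbc : c < b)
    (hv : HasEigenvalueVector ρ ![a, b, c, c, c, c, c, c, c]) :
    ρ ∈ (AP 3 3).extremePoints ℝ := by
  obtain ⟨hmem, hint⟩ := hρ
  obtain ⟨U, hU, hd⟩ := hv.exists_diagonalization hmem.1.1.1 rankEquiv
  have hf : (![a, b, c, c, c, c, c, c, c] : Fin 9 → ℝ) ∘ rankEquiv =
      fun p => threeLevel a b c (indexRank p) := by
    ext ⟨i, j⟩
    fin_cases i <;> fin_cases j <;> rfl
  rw [hf] at hd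
  set f : Fin 3 × Fin 3 → ℝ := fun p => threeLevel a b c (indexRank p) with hfdef
  rw [hd] at hmem
  have hC := formsNonneg_of_mem_AP le_rfl hU hmem
  have hsum := AP_sum_eq_one hU hmem
  rw [sum_indexRank] at hsum
  simp only [threeLevel] at hsum
  have hsum' : a + b + 7 * c = 1 := by linarith
  have hQ : ∀ x : Fin 3 → ℝ, diagForm f x = c * x 0 ^ 2 + c * x 1 ^ 2 + c * x 2 ^ 2
      - (a - c) * (x 0 * x 1) - (b - c) * (x 0 * x 2) := by
    intro x
    rw [diagForm_comp_indexRank]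
    simp only [threeLevel]
    ring
  have hc : 0 < c := by
    have := (hC ![1, 1, 0]).1
    rw [hQ] at this
    simp at this
    linarith
  -- The test vector is the critical direction of the form, where its value is c(4c² − (a−c)² −
  -- (b−c)²).
  have hle : (a - c) ^ 2 + (b - c) ^ 2 ≤ 4 * c ^ 2 := by
    have := (hC ![2 * c, a - c, b - c]).1
    rw [hQ] at this
    simp at this
    have : 0 ≤ c * (4 * c ^ 2 - ((a - c) ^ 2 + (b - c) ^ 2)) := by linarith
    have := nonneg_of_mul_nonneg_right this hc
    linarith
  have heq : (a - c) ^ 2 + (b - c) ^ 2 = 4 * c ^ 2 := by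
    by_contra hne
    have hlt := lt_of_le_of_ne hle hne
    apply hint
    refine ⟨hd ▸ hmem, ?_⟩
    set r := √((a - c) ^ 2 + (b - c) ^ 2) with hr
    have hpos : 0 < (a - c) ^ 2 + (b - c) ^ 2 := by
      have : 0 < a - c := by linarith
      positivity
    have hr0 : 0 < r := Real.sqrt_pos.2 hpos
    have hr2 : r ^ 2 = (a - c) ^ 2 + (b - c) ^ 2 := Real.sq_sqrt hpos.le
    have hrc : r < 2 * c := by nlinarith
    -- Removing ε/9 from each eigenvalue keeps the gaps and lowers `c` to r/2, exactly where the
    -- inequality becomes an equality.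
    set ε := 9 * (c - r / 2) with hε
    have hε1 : ε < 1 := by linarith
    refine ⟨ε, by linarith, hε1, ?_⟩
    set k := 1 / (1 - ε) with hk
    have hk0 : 0 < k := by rw [hk]; exact one_div_pos.2 (by linarith)
    have hk1 : k * (1 - ε) = 1 := by rw [hk]; exact one_div_mul_cancel (by linarith)
    have e : k • (ρ - (ε / (((3 : ℕ) : ℝ) * ((3 : ℕ) : ℝ))) • (1 : Matrix (Fin 3 × Fin 3) _ ℂ)) =
        U * realDiagonal (fun p => threeLevel (k * (a - ε / 9)) (k * (b - ε / 9))
          (k * (c - ε / 9)) (indexRank p)) * Uᴴ := by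
      have e1 : (fun p : Fin 3 × Fin 3 => threeLevel (k * (a - ε / 9)) (k * (b - ε / 9))
          (k * (c - ε / 9)) (indexRank p)) = k • f + (-(k * (ε / 9))) • (fun _ => (1 : ℝ)) := by
        ext p
        simp only [hfdef, Pi.add_apply, Pi.smul_apply, smul_eq_mul]
        match indexRank p with
        | 0 | 1 => simp only [threeLevel]; ring
        | k + 2 => simp only [threeLevel]; ring
      have e2 : U * realDiagonal (fun _ => (1 : ℝ)) * Uᴴ = 1 := by
        have : realDiagonal (fun _ : Fin 3 × Fin 3 => (1 : ℝ)) = 1 := by simp [realDiagonal]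
        rw [this, Matrix.mul_one]
        exact mem_unitaryGroup_iff.1 hU
      rw [e1, realDiagonal_conj_comb, e2, ← hd, smul_sub, smul_smul, sub_eq_add_neg, ← neg_smul]
      norm_num
    rw [e]
    refine threeLevel_mem_AP (mul_le_mul_of_nonneg_left (by linarith) hk0.le)
      (mul_le_mul_of_nonneg_left (by linarith) hk0.le) (mul_pos hk0 (by linarith)) ?_ ?_ hU
    · have e1 : c - ε / 9 = r / 2 := by rw [hε]; ring
      rw [e1]
      have e2 : (k * (a - ε / 9) - k * (r / 2)) ^ 2 + (k * (b - ε / 9) - k * (r / 2)) ^ 2 =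
          k ^ 2 * ((a - c) ^ 2 + (b - c) ^ 2) := by
        rw [← e1]; ring
      rw [e2, ← hr2]
      apply le_of_eq; ring
    · linear_combination k * hsum' + hk1
  have hp : 0 < a - c := by linarith
  have hq : 0 < b - c := by linarith
  rw [hd]
  refine conj_mem_extremePoints (mem_extremePoints_iff_left.2 ⟨?_, fun σ hσ τ hτ hseg => ?_⟩) hU
  · simpa using threeLevel_mem_AP hab.le hbc.le hc hle hsum' (one_mem _)
  -- By `heq` this vector is a zero of the form. Its two smallest products −x₀x₁ < −x₀x₂ lie
  -- strictly below all others, so the three levels are separated.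
  set x : Fin 3 → ℝ := ![2 * c, a - c, b - c] with hx
  have hx0 : x 0 = 2 * c := rfl
  have hx1 : x 1 = a - c := rfl
  have hx2 : x 2 = b - c := rfl
  have hlarge : ∀ r, 2 ≤ r → -(2 * c * (b - c)) < rankEigenvalue x r := by
    intro r hr
    have hac : a - c < 2 * c := by nlinarith
    have hneg : -(2 * c * (b - c)) < 0 := by nlinarith
    match r with
    | 2 => simp only [rankEigenvalue, hx1, hx2]; nlinarith
    | 3 => exact hneg
    | 4 | 5 | 6 | 7 | 8 =>
      simp only [rankEigenvalue, hx0, hx1, hx2]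
      exact hneg.trans (by positivity)
    | k + 9 => simp only [rankEigenvalue, hx0]; exact hneg.trans (by positivity)
  have h01 : rankEigenvalue x 0 < rankEigenvalue x 1 := by
    simp only [rankEigenvalue, hx0, hx1, hx2]; nlinarith
  have h1' : rankEigenvalue x 1 = -(2 * c * (b - c)) := by
    simp only [rankEigenvalue, hx0, hx2]
  have hgap : ∀ r s, threeLevel a b c r ≠ threeLevel a b c s →
      rankEigenvalue x r ≠ rankEigenvalue x s := by
    intro r s hrs
    match r, s with
    | 0, 0 | 1, 1 => exact absurd rfl hrs
    | 0, 1 => exact h01.ne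
    | 1, 0 => exact h01.ne'
    | 0, k + 2 => exact (h01.trans (h1' ▸ hlarge _ (by omega))).ne
    | k + 2, 0 => exact (h01.trans (h1' ▸ hlarge _ (by omega))).ne'
    | 1, k + 2 => exact (h1' ▸ hlarge _ (by omega) : rankEigenvalue x 1 < _).ne
    | k + 2, 1 => exact (h1' ▸ hlarge _ (by omega) : rankEigenvalue x 1 < _).ne'
    | k + 2, l + 2 => exact absurd rfl hrs
  have hcase : ∀ r s, r ≠ s → threeLevel a b c r = threeLevel a b c s → threeLevel a b c r = c := by
    intro r s hrs h
    match r, s with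
    | 0, 0 | 1, 1 => exact absurd rfl hrs
    | 0, 1 => exact absurd h hab.ne'
    | 1, 0 => exact absurd h hab.ne
    | 0, k + 2 => exact absurd h (hbc.trans hab).ne'
    | 1, k + 2 => exact absurd h hbc.ne'
    | k + 2, _ => rfl
  obtain ⟨d, rfl, hdf, -, hgrad⟩ := face_rigidity (f := f) (x := x) le_rfl
    (fun p q hpq => by
      rw [ptEigenvalue_eq_rankEigenvalue x p le_rfl, ptEigenvalue_eq_rankEigenvalue x q le_rfl]
      exact hgap _ _ hpq)
    (fun p q hpq h => by
      have hfp : f p = c := hcase _ _ (fun e => hpq (indexRank_injective e)) h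
      refine ⟨(0, 0), (1, 1), hfp.symm, hfp.symm, Pi.single 0 1, ?_⟩
      simp [ptBilin, extendZero, hx0]
      exact hc.ne')
    hσ hτ hseg (by rw [hQ, hx0, hx1, hx2]; linear_combination (-c) * heq)
  have hds : ∑ p, d p = 1 := AP_sum_eq_one (one_mem _) (by rw [one_conj_realDiagonal]; exact hσ)
  have hdc : ∀ p : Fin 3 × Fin 3, 2 ≤ indexRank p → d p = d (0, 0) := fun p hp =>
    hdf _ _ ((threeLevel_of_two_le a b c hp).trans rfl)
  -- The gradient equations in directions 1 and 2 fix the ratios of the three levels of `d`, and the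
  -- trace fixes the scale.
  have g1 := hgrad (Pi.single 1 1)
  have g2 := hgrad (Pi.single 2 1)
  rw [sum_ptBilin_eq le_rfl] at g1 g2
  simp [hx0, hx1, hx2] at g1 g2
  simp only [Fintype.sum_prod_type, Fin.sum_univ_three] at hds
  have k1 := hdc (0, 1) (by decide)
  have k2 := hdc (0, 2) (by decide)
  have k3 := hdc (1, 1) (by decide)
  have k4 := hdc (1, 2) (by decide)
  have k5 := hdc (2, 1) (by decide)
  have k6 := hdc (2, 2) (by decide)
  rw [k1, k3, k4, k5] at g1
  rw [k2, k4, k5, k6] at g2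
  rw [k1, k2, k3, k4, k5, k6] at hds
  have s1 : d (1, 0) * c = d (0, 0) * a := by linarith
  have s2 : d (2, 0) * c = d (0, 0) * b := by linarith
  have s3 : d (0, 0) = c := by
    linear_combination c * hds - s1 - s2 - d (0, 0) * hsum'
  have s1' : d (1, 0) = a := by rw [s3] at s1; exact mul_right_cancel₀ hc.ne' (by linarith)
  have s2' : d (2, 0) = b := by rw [s3] at s2; exact mul_right_cancel₀ hc.ne' (by linarith)
  congr 1
  ext ⟨i, j⟩
  fin_cases i <;> fin_cases j
  exacts [s3, k1.trans s3, k2.trans s3, s1', k3.trans s3, k4.trans s3, s2', k5.trans s3,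
    k6.trans s3]

end Qutrits

/-! ### Two-level states with a zero of the form -/

section TwoLevel

/-- Eigenvalue profile taking the value `A` on the ranks below `T` and `B` on the others. -/
noncomputable def twoLevel (T : ℕ) (A B : ℝ) (p : Fin 3 × Fin 3) : ℝ :=
  if indexRank p < T then A else B

lemma twoLevel_antivary (T : ℕ) {A B : ℝ} (h : B ≤ A) : Antivary (twoLevel T A B) indexRank := by
  intro p q hpq
  unfold twoLevel
  split_ifs <;> first | exact le_rfl | exact h | omega

/-- `x` is a zero of the positive semidefinite forms attached to the profile `(A, B)`, and separates
its two levels. -/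
structure IsTwoLevelKernel (T : ℕ) (A B : ℝ) (x : Fin 3 → ℝ) : Prop where
  lt : B < A
  nonneg : 0 ≤ B
  pos : 0 < x 0
  forms : FormsNonneg le_rfl (twoLevel T A B)
  zero : diagForm (twoLevel T A B) x = 0
  gap : ∃ m, ∀ r, (r < T → rankEigenvalue x r ≤ m) ∧ (T ≤ r → m < rankEigenvalue x r)

lemma twoLevel_smul (T : ℕ) (A B s : ℝ) : s • twoLevel T A B = twoLevel T (s * A) (s * B) := by
  ext p
  simp only [twoLevel, Pi.smul_apply, smul_eq_mul]
  split_ifs <;> rfl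

lemma diagForm_smul {n : ℕ} (s : ℝ) (d : Fin 3 × Fin n → ℝ) (x : Fin 3 → ℝ) :
    diagForm (s • d) x = s * diagForm d x := by
  unfold diagForm
  rw [Finset.mul_sum]
  refine Finset.sum_congr rfl fun p _ => ?_
  simp [mul_assoc]

lemma diagForm_add {n : ℕ} (d d' : Fin 3 × Fin n → ℝ) (x : Fin 3 → ℝ) :
    diagForm (d + d') x = diagForm d x + diagForm d' x := by
  unfold diagForm
  rw [← Finset.sum_add_distrib]
  refine Finset.sum_congr rfl fun p _ => ?_
  simp [add_mul]

lemma diagForm_one (x : Fin 3 → ℝ) :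
    diagForm (fun _ : Fin 3 × Fin 3 => (1 : ℝ)) x = x 0 ^ 2 + x 1 ^ 2 + x 2 ^ 2 := by
  rw [diagForm_eq le_rfl]; ring

lemma IsTwoLevelKernel.smul {T : ℕ} {A B : ℝ} {x : Fin 3 → ℝ} (h : IsTwoLevelKernel T A B x)
    {s : ℝ} (hs : 0 < s) : IsTwoLevelKernel T (s * A) (s * B) x where
  lt := mul_lt_mul_of_pos_left h.lt hs
  nonneg := mul_nonneg hs.le h.nonneg
  pos := h.pos
  forms := by
    rw [← twoLevel_smul]
    intro y
    have e : (s • twoLevel T A B) ∘ midSwap le_rfl = s • (twoLevel T A B ∘ midSwap le_rfl) := rfl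
    rw [e, diagForm_smul, diagForm_smul]
    exact ⟨mul_nonneg hs.le (h.forms y).1, mul_nonneg hs.le (h.forms y).2⟩
  zero := by rw [← twoLevel_smul, diagForm_smul, h.zero, mul_zero]
  gap := h.gap

lemma maximallyMixed_mem_AP : realDiagonal (fun _ : Fin 3 × Fin 3 => (1 / 9 : ℝ)) ∈ AP 3 3 := by
  rw [← one_conj_realDiagonal]
  refine conj_mem_AP le_rfl (fun _ _ _ => le_rfl) (fun x => ?_) (by simp) (one_mem _)
  have e : (fun _ : Fin 3 × Fin 3 => (1 / 9 : ℝ)) = (1 / 9 : ℝ) • fun _ => (1 : ℝ) := by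
    ext; simp
  have e2 : (fun _ : Fin 3 × Fin 3 => (1 / 9 : ℝ)) ∘ midSwap le_rfl = fun _ => (1 / 9 : ℝ) := rfl
  rw [e2, e, diagForm_smul, diagForm_one]
  constructor <;> positivity

namespace IsTwoLevelKernel

variable {T : ℕ} {A B : ℝ} {x : Fin 3 → ℝ}

lemma mem_AP (h : IsTwoLevelKernel T A B x) (h1 : ∑ p, twoLevel T A B p = 1) :
    realDiagonal (twoLevel T A B) ∈ AP 3 3 := by
  rw [← one_conj_realDiagonal]
  exact conj_mem_AP le_rfl (twoLevel_antivary T h.lt.le) h.forms h1 (one_mem _)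

/-- A diagonal constant on both levels is μ times the profile plus ν times the identity. At `x` the
profile contributes 0 and the identity |x|² > 0, so ν = 0; the trace then gives μ = 1. -/
lemma eq_of_affine (h : IsTwoLevelKernel T A B x) (h1 : ∑ p, twoLevel T A B p = 1)
    {d : Fin 3 × Fin 3 → ℝ} (hd : ∀ p q, twoLevel T A B p = twoLevel T A B q → d p = d q)
    (hd1 : ∑ p, d p = 1) (hd0 : diagForm d x = 0) : d = twoLevel T A B := by
  obtain ⟨μ, ν, hμ⟩ : ∃ μ ν : ℝ, d = μ • twoLevel T A B + ν • fun _ => (1 : ℝ) := by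
    have hAB : A - B ≠ 0 := sub_ne_zero.2 h.lt.ne'
    have key : ∀ u v : ℝ, (∀ p, d p = if indexRank p < T then u else v) →
        ∃ μ ν : ℝ, d = μ • twoLevel T A B + ν • fun _ => (1 : ℝ) := by
      intro u v huv
      refine ⟨(u - v) / (A - B), u - (u - v) / (A - B) * A, ?_⟩
      ext p
      simp only [huv, twoLevel, Pi.add_apply, Pi.smul_apply, smul_eq_mul]
      split_ifs
      · ring
      · field_simp; ring
    by_cases hT : 0 < T
    · refine key (d (1, 0)) (d (0, 0)) fun p => ?_
      split_ifs with hp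
      · apply hd
        have : indexRank ((1, 0) : Fin 3 × Fin 3) = 0 := rfl
        simp [twoLevel, hp, this, hT]
      · by_cases h9 : (9 : ℕ) < T
        · exact absurd ((indexRank_le p).trans_lt h9) hp
        · apply hd
          have : indexRank ((0, 0) : Fin 3 × Fin 3) = 9 := rfl
          simp [twoLevel, hp, this, h9]
    · refine key (d (0, 0)) (d (0, 0)) fun p => ?_
      rw [ite_self]
      apply hd
      simp [twoLevel, Nat.eq_zero_of_not_pos hT]
  have hx := h.pos
  rw [hμ, diagForm_add, diagForm_smul, diagForm_smul, h.zero, diagForm_one] at hd0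
  have hν : ν = 0 := by
    have hpos : 0 < x 0 ^ 2 + x 1 ^ 2 + x 2 ^ 2 := by positivity
    simpa [hpos.ne'] using hd0
  rw [hμ, hν] at hd1
  simp only [zero_smul, add_zero, Pi.smul_apply, smul_eq_mul, ← Finset.mul_sum, h1, mul_one] at hd1
  rw [hμ, hν, hd1]
  simp

lemma extreme (h : IsTwoLevelKernel T A B x) (h1 : ∑ p, twoLevel T A B p = 1) :
    realDiagonal (twoLevel T A B) ∈ (AP 3 3).extremePoints ℝ := by
  refine mem_extremePoints_iff_left.2 ⟨h.mem_AP h1, fun σ hσ τ hτ hseg => ?_⟩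
  obtain ⟨m, hm⟩ := h.gap
  have hval : ∀ p q, twoLevel T A B p ≠ twoLevel T A B q →
      ptEigenvalue x p ≠ ptEigenvalue x q := by
    intro p q hpq
    rw [ptEigenvalue_eq_rankEigenvalue x p le_rfl, ptEigenvalue_eq_rankEigenvalue x q le_rfl]
    unfold twoLevel at hpq
    split_ifs at hpq with hp hq hq
    · exact absurd rfl hpq
    · exact (((hm _).1 hp).trans_lt ((hm _).2 (not_lt.1 hq))).ne
    · exact (((hm _).1 hq).trans_lt ((hm _).2 (not_lt.1 hp))).ne'
    · exact absurd rfl hpq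
  have hx := h.pos
  have hnd : ∀ p q, p ≠ q → twoLevel T A B p = twoLevel T A B q → ∃ p' q',
      twoLevel T A B p' = twoLevel T A B p ∧ twoLevel T A B q' = twoLevel T A B p ∧
      ∃ y, ptBilin x y p' ≠ ptBilin x y q' := by
    intro p q hpq hval
    have hr : indexRank p ≠ indexRank q := fun e => hpq (indexRank_injective e)
    have hiff : indexRank p < T ↔ indexRank q < T := by
      unfold twoLevel at hval
      have := h.lt
      split_ifs at hval with a b b <;> first | exact iff_of_true a b | exact iff_of_false a b | linarith
    by_cases hp : indexRank p < T
    · have hq := hiff.1 hp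
      -- An upper level with two members contains ranks 0 and 1; likewise a lower one contains ranks
      -- 9 and 8. In direction 1 only one member of each pair sees the positive x₀.
      refine ⟨(1, 0), (2, 0), ?_, ?_, Pi.single 1 1, ?_⟩
      · have e : indexRank ((1, 0) : Fin 3 × Fin 3) = 0 := rfl
        rw [twoLevel, twoLevel, if_pos hp, e, if_pos (by omega)]
      · have e : indexRank ((2, 0) : Fin 3 × Fin 3) = 1 := rfl
        rw [twoLevel, twoLevel, if_pos hp, e, if_pos (by omega)]
      · simp [ptBilin, extendZero, hx.ne']
    · have hq := fun hq => hp (hiff.2 hq)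
      have b1 := indexRank_le p
      have b2 := indexRank_le q
      refine ⟨(0, 0), (0, 1), ?_, ?_, Pi.single 1 1, ?_⟩
      · have e : indexRank ((0, 0) : Fin 3 × Fin 3) = 9 := rfl
        rw [twoLevel, twoLevel, if_neg hp, e, if_neg (by omega)]
      · have e : indexRank ((0, 1) : Fin 3 × Fin 3) = 8 := rfl
        rw [twoLevel, twoLevel, if_neg hp, e, if_neg (by omega)]
      · simp [ptBilin, extendZero, hx.ne]
  obtain ⟨d, rfl, hdf, hd0, -⟩ := face_rigidity le_rfl hval hnd hσ hτ hseg h.zero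
  have hds : ∑ p, d p = 1 := AP_sum_eq_one (one_mem _) (by rw [one_conj_realDiagonal]; exact hσ)
  rw [h.eq_of_affine h1 hdf hds hd0]

/-- The profile (a, b) is s times (A, B) plus a multiple of the maximally mixed state, with s the
ratio of the level gaps. Nonnegativity at the kernel vector makes that multiple nonnegative, so
extremality excludes a proper mixture. -/
lemma eq_of_extreme (h : IsTwoLevelKernel T A B x) (h1 : ∑ p, twoLevel T A B p = 1) {a b : ℝ}
    (hab : b < a) (hext : realDiagonal (twoLevel T a b) ∈ (AP 3 3).extremePoints ℝ) :
    realDiagonal (twoLevel T a b) = realDiagonal (twoLevel T A B) := by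
  have hmem : 1 * realDiagonal (twoLevel T a b) * (1 : Matrix (Fin 3 × Fin 3) _ ℂ)ᴴ ∈ AP 3 3 := by
    rw [one_conj_realDiagonal]; exact hext.1
  have hsum := AP_sum_eq_one (one_mem _) hmem
  have hC := (formsNonneg_of_mem_AP le_rfl (one_mem _) hmem x).1
  have hAB : 0 < A - B := sub_pos.2 h.lt
  set s := (a - b) / (A - B) with hs
  have hs0 : 0 < s := div_pos (sub_pos.2 hab) hAB
  have hsAB : s * (A - B) = a - b := div_mul_cancel₀ _ hAB.ne'
  have hdec : twoLevel T a b = s • twoLevel T A B + (9 * (b - s * B)) • fun _ => (1 / 9 : ℝ) := by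
    ext p
    simp only [twoLevel, Pi.add_apply, Pi.smul_apply, smul_eq_mul]
    split_ifs
    · linarith
    · ring
  have hs1 : s + 9 * (b - s * B) = 1 := by
    rw [hdec] at hsum
    simp only [Pi.add_apply, Pi.smul_apply, smul_eq_mul, Finset.sum_add_distrib, ← Finset.mul_sum,
      h1] at hsum
    simpa using hsum
  have hν : 0 ≤ 9 * (b - s * B) := by
    have e : (fun _ : Fin 3 × Fin 3 => (1 / 9 : ℝ)) = (1 / 9 : ℝ) • fun _ => (1 : ℝ) := by
      ext; simp
    rw [hdec, diagForm_add, diagForm_smul, h.zero, e, diagForm_smul, diagForm_smul, diagForm_one]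
      at hC
    have hx := h.pos
    have hpos : 0 < 1 / 9 * (x 0 ^ 2 + x 1 ^ 2 + x 2 ^ 2) := by positivity
    rw [mul_zero, zero_add] at hC
    exact nonneg_of_mul_nonneg_left hC hpos
  rcases hν.lt_or_eq with hν | hν
  · refine (hext.2 (h.mem_AP h1) maximallyMixed_mem_AP ⟨s, 9 * (b - s * B), hs0, hν, hs1, ?_⟩).symm
    rw [hdec, ← one_conj_realDiagonal (s • _ + _), realDiagonal_conj_comb, one_conj_realDiagonal,
      one_conj_realDiagonal]
  · have : s = 1 := by linarith
    rw [hdec, ← hν, this]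
    simp

end IsTwoLevelKernel

lemma formsNonneg_twoLevel {T : ℕ} {A B : ℝ}
    (h1 : ∀ x y z : ℝ, 0 ≤ (if 9 < T then A else B) * x ^ 2 + (if 7 < T then A else B) * y ^ 2 +
      (if 4 < T then A else B) * z ^ 2 +
      ((if 8 < T then A else B) - (if 0 < T then A else B)) * (x * y) +
      ((if 6 < T then A else B) - (if 1 < T then A else B)) * (x * z) +
      ((if 5 < T then A else B) - (if 2 < T then A else B)) * (y * z))
    (h2 : ∀ x y z : ℝ, 0 ≤ (if 9 < T then A else B) * x ^ 2 + (if 6 < T then A else B) * y ^ 2 +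
      (if 4 < T then A else B) * z ^ 2 +
      ((if 8 < T then A else B) - (if 0 < T then A else B)) * (x * y) +
      ((if 7 < T then A else B) - (if 1 < T then A else B)) * (x * z) +
      ((if 5 < T then A else B) - (if 2 < T then A else B)) * (y * z)) :
    FormsNonneg le_rfl (twoLevel T A B) := by
  intro x
  constructor
  · exact (diagForm_comp_indexRank (fun r => if r < T then A else B) x).symm ▸ h1 _ _ _
  · exact (diagForm_comp_midSwap (fun r => if r < T then A else B) x).symm ▸ h2 _ _ _

lemma diagForm_twoLevel (T : ℕ) (A B x y z : ℝ) :
    diagForm (twoLevel T A B) ![x, y, z] = (if 9 < T then A else B) * x ^ 2 +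
      (if 7 < T then A else B) * y ^ 2 + (if 4 < T then A else B) * z ^ 2 +
      ((if 8 < T then A else B) - (if 0 < T then A else B)) * (x * y) +
      ((if 6 < T then A else B) - (if 1 < T then A else B)) * (x * z) +
      ((if 5 < T then A else B) - (if 2 < T then A else B)) * (y * z) :=
  diagForm_comp_indexRank (fun r => if r < T then A else B) ![x, y, z]

/-- `rankEigenvalue` is constant from 9 on, so ten ranks decide. -/
lemma gap_of_ranks {T : ℕ} (hT : T ≤ 9) {x : Fin 3 → ℝ} (m : ℝ)
    (h1 : ∀ r : Fin 10, (r : ℕ) < T → rankEigenvalue x r ≤ m)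
    (h2 : ∀ r : Fin 10, T ≤ (r : ℕ) → m < rankEigenvalue x r) :
    ∃ m, ∀ r, (r < T → rankEigenvalue x r ≤ m) ∧ (T ≤ r → m < rankEigenvalue x r) := by
  refine ⟨m, fun r => ⟨fun hr => h1 ⟨r, by omega⟩ hr, fun hr => ?_⟩⟩
  by_cases h : r < 10
  · exact h2 ⟨r, h⟩ hr
  · have : rankEigenvalue x r = rankEigenvalue x 9 := by
      obtain ⟨k, rfl⟩ := Nat.exists_eq_add_of_le' (not_lt.1 h)
      rfl
    rw [this]
    exact h2 9 hT

end TwoLevel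

/-! ### The eight critical profiles -/

section Profiles

lemma kernel_one : IsTwoLevelKernel 1 3 1 ![1, 1, 0] where
  lt := by norm_num
  nonneg := by norm_num
  pos := by simp
  forms := formsNonneg_twoLevel
    (fun x y z => by norm_num; nlinarith [sq_nonneg (x - y), sq_nonneg z])
    (fun x y z => by norm_num; nlinarith [sq_nonneg (x - y), sq_nonneg z])
  zero := by rw [diagForm_twoLevel]; norm_num
  gap := gap_of_ranks (by norm_num) (-1)
    (fun r hr => by fin_cases r <;> simp [rankEigenvalue] at hr ⊢)
    (fun r hr => by fin_cases r <;> simp [rankEigenvalue] at hr ⊢)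

/-- The value √2 + 1 comes from 2(A − 1)² = 4, the equality case of `star_form_nonneg` with c = 1.
-/
lemma kernel_two : IsTwoLevelKernel 2 (√2 + 1) 1 ![√2, 1, 1] where
  lt := by simp
  nonneg := by norm_num
  pos := by simp
  forms := by
    have h := Real.sq_sqrt (show (0 : ℝ) ≤ 2 by norm_num)
    refine formsNonneg_twoLevel (fun x y z => ?_) (fun x y z => ?_) <;> norm_num <;>
      nlinarith [sq_nonneg (√2 * y - x), sq_nonneg (√2 * z - x)]
  zero := by rw [diagForm_twoLevel]; norm_num
  gap := by
    have h : (1 : ℝ) < √2 := Real.lt_sqrt_of_sq_lt (by norm_num)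
    exact gap_of_ranks (by norm_num) (-√2)
      (fun r hr => by fin_cases r <;> simp [rankEigenvalue] at hr ⊢)
      (fun r hr => by fin_cases r <;> simp [rankEigenvalue] at hr ⊢ <;> linarith)

lemma kernel_three : IsTwoLevelKernel 4 2 1 ![1, 1, 1] where
  lt := by norm_num
  nonneg := by norm_num
  pos := by simp
  forms := formsNonneg_twoLevel
    (fun x y z => by norm_num; nlinarith [sq_nonneg (x - y), sq_nonneg (x - z), sq_nonneg (y - z)])
    (fun x y z => by norm_num; nlinarith [sq_nonneg (x - y), sq_nonneg (x - z), sq_nonneg (y - z)])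
  zero := by rw [diagForm_twoLevel]; norm_num
  gap := gap_of_ranks (by norm_num) 0
    (fun r hr => by fin_cases r <;> simp [rankEigenvalue] at hr ⊢)
    (fun r hr => by fin_cases r <;> simp [rankEigenvalue] at hr ⊢)

/-- The form is symmetric in x and y, so its zero has x = y. Minimizing over z along x = y leaves
the quadratic in `A` as the singularity condition. -/
lemma kernel_four {A : ℝ} (hA : 2 * A ^ 2 - 5 * A + 1 = 0) (h1 : 1 < A) :
    IsTwoLevelKernel 5 A 1 ![A, A, A - 1] where
  lt := h1
  nonneg := by norm_num
  pos := by simp; linarith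
  forms := by
    have key : ∀ x y z : ℝ, 0 ≤ x ^ 2 + y ^ 2 + A * z ^ 2 + (1 - A) * (x * y) + (1 - A) * (x * z)
        + (1 - A) * (y * z) := by
      intro x y z
      have : 0 ≤ A * (x ^ 2 + y ^ 2 + A * z ^ 2 + (1 - A) * (x * y) + (1 - A) * (x * z)
        + (1 - A) * (y * z)) := by
        have e : A * (x ^ 2 + y ^ 2 + A * z ^ 2 + (1 - A) * (x * y) + (1 - A) * (x * z)
          + (1 - A) * (y * z)) =
          (A * z - (A - 1) * (x + y) / 2) ^ 2 + A * (1 + A) / 4 * (x - y) ^ 2 := by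
          linear_combination (-(x + y) ^ 2 / 4) * hA
        rw [e]
        positivity
      exact nonneg_of_mul_nonneg_right this (by linarith)
    refine formsNonneg_twoLevel (fun x y z => ?_) (fun x y z => ?_) <;> norm_num <;>
      linarith [key x y z]
  zero := by
    rw [diagForm_twoLevel]; norm_num
    linear_combination (-A) * hA
  gap := by
    have hu : 0 < A - 1 := by linarith
    exact gap_of_ranks (by norm_num) ((A - 1) ^ 2)
      (fun r hr => by fin_cases r <;> simp [rankEigenvalue] at hr ⊢ <;> nlinarith)
      (fun r hr => by fin_cases r <;> simp [rankEigenvalue] at hr ⊢ <;> nlinarith)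

/-- Ranks 2 and 5 both carry `A`, so the yz term cancels. Completing squares gives y = (A−1)x/2 and
z = (A−1)x/(2A), and the remainder vanishes exactly on the cubic. The bound A < 3 gives x₁ < x₀,
which separates x₁x₂ from x₀x₂. -/
lemma kernel_five {A : ℝ} (hA : A ^ 3 - A ^ 2 - 5 * A + 1 = 0) (h1 : 1 < A) (h2 : A < 3) :
    IsTwoLevelKernel 6 A 1 ![2 * A, (A - 1) * A, A - 1] where
  lt := h1
  nonneg := by norm_num
  pos := by simp; linarith
  forms := by
    have key : ∀ x y z : ℝ, 0 ≤ x ^ 2 + y ^ 2 + A * z ^ 2 + (1 - A) * (x * y) +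
        (1 - A) * (x * z) := by
      intro x y z
      have : 0 ≤ 4 * A * (x ^ 2 + y ^ 2 + A * z ^ 2 + (1 - A) * (x * y) + (1 - A) * (x * z)) := by
        have e : 4 * A * (x ^ 2 + y ^ 2 + A * z ^ 2 + (1 - A) * (x * y) + (1 - A) * (x * z)) =
          A * (2 * y - (A - 1) * x) ^ 2 + (2 * A * z - (A - 1) * x) ^ 2 := by
          linear_combination (-x ^ 2) * hA
        rw [e]
        positivity
      exact nonneg_of_mul_nonneg_right this (by linarith)
    refine formsNonneg_twoLevel (fun x y z => ?_) (fun x y z => ?_) <;> norm_num <;>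
      linarith [key x y z]
  zero := by
    rw [diagForm_twoLevel]; norm_num
    linear_combination (-A) * hA
  gap := by
    have hu : 0 < A - 1 := by linarith
    have hu2 : A - 1 < 2 := by linarith
    have hA0 : 0 < A := by linarith
    have hp : 0 < (A - 1) * A := mul_pos hu hA0
    exact gap_of_ranks (by norm_num) ((A - 1) ^ 2 * A)
      (fun r hr => by fin_cases r <;> simp [rankEigenvalue] at hr ⊢ <;> nlinarith)
      (fun r hr => by fin_cases r <;> simp [rankEigenvalue] at hr ⊢ <;> nlinarith)

/-- Here the threshold falls between ranks 6 and 7, so the two forms differ; only the first needs to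
vanish at the kernel vector. -/
lemma kernel_six : IsTwoLevelKernel 7 3 1 ![1, 1, 0] where
  lt := by norm_num
  nonneg := by norm_num
  pos := by simp
  forms := formsNonneg_twoLevel
    (fun x y z => by norm_num; nlinarith [sq_nonneg (x - y), sq_nonneg z])
    (fun x y z => by
      norm_num
      nlinarith [sq_nonneg (x - y - z), sq_nonneg (y - z), sq_nonneg y, sq_nonneg z])
  zero := by rw [diagForm_twoLevel]; norm_num
  gap := gap_of_ranks (by norm_num) 0
    (fun r hr => by fin_cases r <;> simp [rankEigenvalue] at hr ⊢)
    (fun r hr => by fin_cases r <;> simp [rankEigenvalue] at hr ⊢)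

/-- The (x, y) part is a perfect square when (A − 1)² = 4A. -/
lemma kernel_seven : IsTwoLevelKernel 8 (3 + 2 * √2) 1 ![1 + √2, 1, 0] where
  lt := by nlinarith [Real.sqrt_nonneg 2]
  nonneg := by norm_num
  pos := by simp; positivity
  forms := by
    have h := Real.sq_sqrt (show (0 : ℝ) ≤ 2 by norm_num)
    have key : ∀ x y z : ℝ, 0 ≤ x ^ 2 + (3 + 2 * √2) * y ^ 2 + (3 + 2 * √2) * z ^ 2 +
        (1 - (3 + 2 * √2)) * (x * y) := by
      intro x y z
      have e : x ^ 2 + (3 + 2 * √2) * y ^ 2 + (3 + 2 * √2) * z ^ 2 + (1 - (3 + 2 * √2)) * (x * y)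
          = (x - (1 + √2) * y) ^ 2 + (3 + 2 * √2) * z ^ 2 := by
        linear_combination (-y ^ 2) * h
      rw [e]; positivity
    refine formsNonneg_twoLevel (fun x y z => ?_) (fun x y z => ?_) <;> norm_num <;>
      linarith [key x y z]
  zero := by
    have h := Real.sq_sqrt (show (0 : ℝ) ≤ 2 by norm_num)
    rw [diagForm_twoLevel]; norm_num
    linear_combination (-1 : ℝ) * h
  gap := by
    have h : (1 : ℝ) < √2 := Real.lt_sqrt_of_sq_lt (by norm_num)
    exact gap_of_ranks (by norm_num) 1
      (fun r hr => by fin_cases r <;> simp [rankEigenvalue] at hr ⊢; linarith)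
      (fun r hr => by
        fin_cases r <;> simp [rankEigenvalue] at hr ⊢
        exact lt_abs.2 (.inl (by linarith)))

lemma kernel_eight : IsTwoLevelKernel 9 1 0 ![1, 0, 0] where
  lt := by norm_num
  nonneg := by norm_num
  pos := by simp
  forms := formsNonneg_twoLevel (fun x y z => by norm_num; positivity)
    (fun x y z => by norm_num; positivity)
  zero := by rw [diagForm_twoLevel]; norm_num
  gap := gap_of_ranks (by norm_num) 0
    (fun r hr => by fin_cases r <;> simp [rankEigenvalue] at hr ⊢)
    (fun r hr => by fin_cases r <;> simp [rankEigenvalue] at hr ⊢)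

end Profiles

/-! ### Classification of extreme states with two eigenvalues -/

section Classification

/-- Number of ranks (out of `0, …, 9`, rank `3` being unused) carrying the larger eigenvalue. -/
def levelThreshold : Fin 8 → ℕ := ![1, 2, 4, 5, 6, 7, 8, 9]

/-- The lexicographic order of the basis and the rank order differ by a permutation, which is
unitary. -/
lemma unitarilyEquivalent_zeta_aux {T : ℕ} {A B s : ℝ} {v : Fin 9 → ℝ}
    (hv : ∀ p, v (rankEquiv p) = twoLevel T A B p) :
    ∃ U ∈ unitaryGroup (Fin 3 × Fin 3) ℂ,
      s • diag33 v = U * realDiagonal (twoLevel T (s * A) (s * B)) * Uᴴ := by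
  obtain ⟨P, hP, hd⟩ := conj_realDiagonal_comp_perm
    (finProdFinEquiv.trans rankEquiv.symm : Equiv.Perm (Fin 3 × Fin 3)) (s • twoLevel T A B)
  refine ⟨P, hP, ?_⟩
  rw [← twoLevel_smul, ← hd]
  ext p q
  by_cases hpq : p = q
  · subst hpq
    simp [diag33, realDiagonal, ← hv]
  · simp [diag33, realDiagonal, hpq]

lemma sum_twoLevel (T : ℕ) (A B : ℝ) : ∑ p, twoLevel T A B p =
    (if 0 < T then A else B) + (if 1 < T then A else B) + (if 2 < T then A else B) +
    (if 4 < T then A else B) + (if 5 < T then A else B) + (if 6 < T then A else B) +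
    (if 7 < T then A else B) + (if 8 < T then A else B) + (if 9 < T then A else B) :=
  sum_indexRank (fun r => if r < T then A else B)

/-- The data attached to a two-level extreme state. -/
def IsTwoLevelExtreme (T : ℕ) (ζ : Matrix (Fin 3 × Fin 3) (Fin 3 × Fin 3) ℂ) : Prop :=
  ∃ (A B : ℝ) (x : Fin 3 → ℝ), IsTwoLevelKernel T A B x ∧ ∑ p, twoLevel T A B p = 1 ∧
    ∃ U ∈ unitaryGroup (Fin 3 × Fin 3) ℂ, ζ = U * realDiagonal (twoLevel T A B) * Uᴴ

lemma isTwoLevelExtreme_of_kernel {T : ℕ} {A B s : ℝ} {x : Fin 3 → ℝ} {v : Fin 9 → ℝ}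
    (h : IsTwoLevelKernel T A B x) (hv : ∀ p, v (rankEquiv p) = twoLevel T A B p)
    (hs : s * ∑ p, twoLevel T A B p = 1) (hs0 : 0 < s) :
    IsTwoLevelExtreme T (s • diag33 v) := by
  refine ⟨s * A, s * B, x, h.smul hs0, ?_, unitarilyEquivalent_zeta_aux hv⟩
  rw [← twoLevel_smul, ← hs, Finset.mul_sum]
  rfl

lemma zeta_isTwoLevelExtreme {x : ℝ} (hx : x ^ 3 - x ^ 2 - 5 * x + 1 = 0) (h1 : 1 < x) (h3 : x < 3)
    (k : Fin 8) : IsTwoLevelExtreme (levelThreshold k) (zeta x k) := by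
  have h17 : (1 : ℝ) < √17 := Real.lt_sqrt_of_sq_lt (by norm_num)
  have hs17 := Real.sq_sqrt (show (0 : ℝ) ≤ 17 by norm_num)
  fin_cases k
  · change IsTwoLevelExtreme 1 _
    refine isTwoLevelExtreme_of_kernel kernel_one ?_ ?_ (by norm_num)
    · rintro ⟨i, j⟩
      fin_cases i <;> fin_cases j <;> rfl
    · rw [sum_twoLevel]; norm_num
  · change IsTwoLevelExtreme 2 _
    refine isTwoLevelExtreme_of_kernel kernel_two ?_ ?_ (by positivity)
    · rintro ⟨i, j⟩
      fin_cases i <;> fin_cases j <;> rfl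
    · rw [sum_twoLevel, one_div, inv_mul_eq_div, div_eq_one_iff_eq (by positivity)]
      norm_num; ring
  · change IsTwoLevelExtreme 4 _
    refine isTwoLevelExtreme_of_kernel kernel_three ?_ ?_ (by norm_num)
    · rintro ⟨i, j⟩
      fin_cases i <;> fin_cases j <;> rfl
    · rw [sum_twoLevel]; norm_num
  · change IsTwoLevelExtreme 5 _
    refine isTwoLevelExtreme_of_kernel (kernel_four (A := (5 + √17) / 4)
      (by linear_combination 1 / 8 * hs17) (by linarith)) ?_ ?_ (by positivity)
    · rintro ⟨i, j⟩
      fin_cases i <;> fin_cases j <;> rfl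
    · rw [sum_twoLevel, one_div, inv_mul_eq_div, div_eq_one_iff_eq (by positivity)]
      norm_num; ring
  · change IsTwoLevelExtreme 6 _
    refine isTwoLevelExtreme_of_kernel (kernel_five hx h1 h3) ?_ ?_
      (one_div_pos.2 (by linarith))
    · rintro ⟨i, j⟩
      fin_cases i <;> fin_cases j <;> rfl
    · rw [sum_twoLevel, one_div, inv_mul_eq_div, div_eq_one_iff_eq (by linarith)]
      norm_num; ring
  · change IsTwoLevelExtreme 7 _
    refine isTwoLevelExtreme_of_kernel kernel_six ?_ ?_ (by norm_num)
    · rintro ⟨i, j⟩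
      fin_cases i <;> fin_cases j <;> rfl
    · rw [sum_twoLevel]; norm_num
  · change IsTwoLevelExtreme 8 _
    refine isTwoLevelExtreme_of_kernel kernel_seven ?_ ?_ (by positivity)
    · rintro ⟨i, j⟩
      fin_cases i <;> fin_cases j <;> rfl
    · rw [sum_twoLevel, one_div, inv_mul_eq_div, div_eq_one_iff_eq (by positivity)]
      norm_num; ring
  · change IsTwoLevelExtreme 9 _
    refine isTwoLevelExtreme_of_kernel kernel_eight ?_ ?_ (by norm_num)
    · rintro ⟨i, j⟩
      fin_cases i <;> fin_cases j <;> rfl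
    · rw [sum_twoLevel]; norm_num

lemma IsTwoLevelExtreme.extreme {T : ℕ} {ζ : Matrix (Fin 3 × Fin 3) (Fin 3 × Fin 3) ℂ}
    (h : IsTwoLevelExtreme T ζ) : ζ ∈ (AP 3 3).extremePoints ℝ := by
  obtain ⟨A, B, x, hk, h1, U, hU, rfl⟩ := h
  exact conj_mem_extremePoints (hk.extreme h1) hU

lemma IsTwoLevelExtreme.encard_spectrum {T : ℕ} {ζ : Matrix (Fin 3 × Fin 3) (Fin 3 × Fin 3) ℂ}
    (h : IsTwoLevelExtreme T ζ) (hT0 : 0 < T) (hT : T ≤ 9) : (spectrum ℂ ζ).encard = 2 := by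
  obtain ⟨A, B, x, hk, h1, U, hU, rfl⟩ := h
  rw [spectrum_unitary_conj hU, Complex.ofReal_injective.encard_image]
  have : Set.range (twoLevel T A B) = {A, B} := by
    ext r
    simp only [Set.mem_range, Set.mem_insert_iff, Set.mem_singleton_iff]
    constructor
    · rintro ⟨p, rfl⟩
      unfold twoLevel
      split_ifs <;> simp
    · rintro (rfl | rfl)
      · exact ⟨(1, 0), if_pos hT0⟩
      · exact ⟨(0, 0), if_neg (not_lt.2 hT)⟩
  rw [this, Set.encard_pair hk.lt.ne']

/-- The threshold is the first rank carrying `b`. It is positive because `a` occurs, and never 3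
because no index has that rank, so it is one of the eight listed. -/
lemma exists_twoLevel_of_range {f : Fin 3 × Fin 3 → ℝ} (hf : Antivary f indexRank) {a b : ℝ}
    (hab : b < a) (hr : Set.range f = {a, b}) : ∃ k, f = twoLevel (levelThreshold k) a b := by
  have hval : ∀ p, f p = a ∨ f p = b := fun p => by
    have : f p ∈ Set.range f := ⟨p, rfl⟩
    rw [hr] at this
    simpa using this
  obtain ⟨pa, hpa⟩ : a ∈ Set.range f := by rw [hr]; simp
  have hex : ∃ T, ∃ p, indexRank p = T ∧ f p = b := by
    obtain ⟨pb, hpb⟩ : b ∈ Set.range f := by rw [hr]; simp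
    exact ⟨_, pb, rfl, hpb⟩
  classical
  obtain ⟨p₀, hp₀, hfp₀⟩ := Nat.find_spec hex
  set T := Nat.find hex with hT
  have hfT : f = twoLevel T a b := by
    ext p
    unfold twoLevel
    split_ifs with h
    · exact (hval p).resolve_right fun hb => Nat.find_min hex h ⟨p, rfl, hb⟩
    · rcases (not_lt.1 h).lt_or_eq with h | h
      · rw [← hp₀] at h
        have := hf h
        rcases hval p with e | e
        · linarith
        · exact e
      · rw [indexRank_injective (h.symm.trans hp₀.symm)]
        exact hfp₀
  have hT0 : T ≠ 0 := by
    intro h0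
    rw [hfT, h0] at hpa
    simp [twoLevel] at hpa
    linarith
  have hk : ∀ p : Fin 3 × Fin 3, indexRank p ≠ 0 → ∃ k, levelThreshold k = indexRank p := by
    decide
  obtain ⟨k, hk⟩ := hk p₀ (by rw [hp₀]; exact hT0)
  exact ⟨k, by rw [hk, hp₀]; exact hfT⟩

lemma extreme_two_level_iff {x : ℝ} (hx : x ^ 3 - x ^ 2 - 5 * x + 1 = 0) (h1 : 1 < x) (h3 : x < 3)
    {ρ : Matrix (Fin 3 × Fin 3) (Fin 3 × Fin 3) ℂ} (hρ : (spectrum ℂ ρ).encard = 2) :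
    ρ ∈ (AP 3 3).extremePoints ℝ ↔ ∃ k : Fin 8, UnitarilyEquivalent ρ (zeta x k) := by
  constructor
  · intro hext
    obtain ⟨U, hU, f, rfl, hf⟩ := exists_sorted_of_mem_AP hext.1
    rw [spectrum_unitary_conj hU, Complex.ofReal_injective.encard_image, Set.encard_eq_two] at hρ
    obtain ⟨a, b, hab, hr⟩ : ∃ a b : ℝ, b < a ∧ Set.range f = {a, b} := by
      obtain ⟨a, b, hne, hr⟩ := hρ
      rcases hne.lt_or_gt with h | h
      · exact ⟨b, a, h, by rw [hr, Set.pair_comm]⟩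
      · exact ⟨a, b, h, hr⟩
    obtain ⟨k, rfl⟩ := exists_twoLevel_of_range hf hab hr
    have hext' := conj_mem_extremePoints hext (Unitary.star_mem hU)
    rw [star_eq_conjTranspose, conjTranspose_conjTranspose, conj_conj_star hU] at hext'
    obtain ⟨A, B, y, hk, hs, V, hV, hz⟩ := zeta_isTwoLevelExtreme hx h1 h3 k
    refine ⟨k, U * Vᴴ, mul_mem hU (Unitary.star_mem hV), ?_⟩
    rw [hk.eq_of_extreme hs hab hext', ← conj_comp, hz, conjTranspose_conjTranspose,
      conj_conj_star hV]
  · rintro ⟨k, U, hU, rfl⟩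
    exact conj_mem_extremePoints (zeta_isTwoLevelExtreme hx h1 h3 k).extreme hU

lemma exists_cubic_root : ∃ x : ℝ, x ^ 3 - x ^ 2 - 5 * x + 1 = 0 ∧ |x - 2.70928| < 0.00001 := by
  -- The cubic changes sign on this interval, whose endpoints lie within 9·10⁻⁶ of 2.70928.
  have hc : ContinuousOn (fun x : ℝ => x ^ 3 - x ^ 2 - 5 * x + 1)
      (Set.Icc 2.709271 2.709289) := by fun_prop
  obtain ⟨x, hx, h0⟩ := intermediate_value_Icc (by norm_num) hc
    (show (0 : ℝ) ∈ Set.Icc _ _ by constructor <;> norm_num)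
  refine ⟨x, h0, ?_⟩
  rw [abs_lt]
  constructor <;> norm_num <;> linarith [hx.1, hx.2]

end Classification

theorem corollary4p1 :
    -- (i), with `x ≈ 2.70928` a root of `x³ - x² - 5x + 1`
    (∃ x : ℝ, x ^ 3 - x ^ 2 - 5 * x + 1 = 0 ∧ |x - 2.70928| < 0.00001 ∧
      (∀ k : Fin 8, zeta x k ∈ AP 3 3 ∧ (spectrum ℂ (zeta x k)).encard = 2) ∧
      ∀ ρ ∈ AP 3 3, (spectrum ℂ ρ).encard = 2 →
        (ρ ∈ (AP 3 3).extremePoints ℝ ↔ ∃ k : Fin 8, UnitarilyEquivalent ρ (zeta x k))) ∧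
    -- (ii)
    (∀ (ρ : Matrix (Fin 3 × Fin 3) (Fin 3 × Fin 3) ℂ) (a b c : ℝ),
      IsBoundaryPointAP ρ → b < a → c < b →
        HasEigenvalueVector ρ ![a, b, c, c, c, c, c, c, c] →
          ρ ∈ (AP 3 3).extremePoints ℝ) ∧
    -- (iii), the case `n = 3` being two qutrits
    (∀ n : ℕ, ∀ ρ ∈ (AP 3 n).extremePoints ℝ, (spectrum ℂ ρ).encard ≤ 7) := by
  refine ⟨?_, boundary_three_level_extreme, extreme_spectrum_encard_le⟩
  obtain ⟨x, hx, hx'⟩ := exists_cubic_root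
  have hb := abs_lt.1 hx'
  have h1 : 1 < x := by norm_num at hb; linarith [hb.1]
  have h3 : x < 3 := by norm_num at hb; linarith [hb.2]
  refine ⟨x, hx, hx', fun k => ?_, fun ρ _ hρ => extreme_two_level_iff hx h1 h3 hρ⟩
  have hk := zeta_isTwoLevelExtreme hx h1 h3 k
  refine ⟨hk.extreme.1, hk.encard_spectrum ?_ ?_⟩ <;> clear hk <;> revert k <;> decide
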